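/- Let $(M,c)$ be a smooth conformal manifold of dimension $n\ge 3$ and of any signature (in particular positive definite). Work in an arbitrary scale $g\in c$, which trivializes the density bundles. Let $\nabla$ be its Levi-Civita connection, $R_{ab}{}^c{}_d$ its curvature, with $(\nabla_a\nabla_b-\nabla_b\nabla_a)v^c=R_{ab}{}^c{}_dv^d$, let $\mathrm{Ric}_{ab}=R_{ca}{}^c{}_b$, and let $P_{ab}$ be the Schouten tensor, $\mathrm{Ric}_{ab}=(n-2)P_{ab}+J g_{ab}$, $J=g^{ab}P_{ab}$. The standard tractor bundle $\mathcal T$ is then the bundle of triples $(\sigma,\mu^a,\rho)$ with metric $\langle(\sigma,\mu,\rho),(\tau,\nu,\pi)\rangle=\mu_a\nu^a+\sigma\pi+\rho\tau$ and tractor connection $$\nabla_a(\sigma,\mu^b,\rho)=(\nabla_a\sigma-\mu_a,\ \nabla_a\mu^b+\delta_a{}^b\rho+P_a{}^b\sigma,\ \nabla_a\rho-P_{ac}\mu^c),$$ whose curvature is $\Omega_{ab}\in\Lambda^2\mathcal T$. Let $\Gamma$ be a smooth, nowhere null (in positive definite signature: regular) parametrized curve in $M$, with tangent vector $U^a$,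 $\frac{d}{dt}=U^c\nabla_c$, $U'^a=\frac{d}{dt}U^a$, $U''^a=\frac{d}{dt}U'^a$ and $u=\sqrt{|U_cU^c|}$. Put $\mathbf T=(0,0,u^{-1})$, $\mathbf U=\frac{d}{dt}\mathbf T$, $\mathbf U'=\frac{d}{dt}\mathbf U$ (derivatives by the tractor connection). Suppose that $\Gamma$ is a conformal circle with a projective parameter, i.e. $$U_{[a}U''_{b]}=\tfrac{3\,U_dU'^d}{U_cU^c}\,U_{[a}U'_{b]}+(U_cU^c)\,U_{[a}P_{b]d}U^d\qquad\text{and}\qquad\langle\mathbf U',\mathbf U'\rangle=0 .$$ Let $k^a$ be a smooth conformal Killing field (the trace-free part of $\nabla_{(a}k_{b)}$ vanishes), and let $\mathbf K=L(k)\in\Lambda^2\mathcal T$ be its image under the BGG splitting operator. Explicitly, $\mathbf K(V,W)=\langle SV,W\rangle$ with $$S(\sigma,\mu^a,\rho)=(\varphi\sigma-k_c\mu^c,\ \sigma r^a+m^a{}_c\mu^c+\rho k^a,\ -\varphi\rho-r_c\mu^c),$$ $$m_{ab}=\nabla_{[b}k_{a]},\qquad \varphi=\tfrac1n\nabla_ck^c,\qquad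 r_b=\tfrac1n\left(\nabla_b\varphi-\nabla^am_{ba}+2P_{bc}k^c-Jk_b\right).$$ Let $\ell_a=U^b\,\Omega_{ab}(\mathbf U,\mathbf U')$ along $\Gamma$ and suppose that $k^a\ell_a=0$ along $\Gamma$. Then $\mathfrak k=\mathbf K(\mathbf U,\mathbf U')$ is conserved along $\Gamma$: $\frac{d}{dt}\mathfrak k=0$. -/

import Mathlib

open scoped Manifold ContDiff Bundle

noncomputable section

namespace ConformalTractor

/-! ### Calculus in local coordinates

`G` is the matrix `g_{ij}` of a (pseudo-Riemannian) metric in local coordinates `y¹, …, yⁿ`.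
Indices range over `Fin n`; vectors and covectors are given by their components. -/

/-- The coordinate space. -/
abbrev Coord (n : ℕ) : Type := EuclideanSpace ℝ (Fin n)

/-- A field of `n × n` matrices in coordinates (the components `g_{ij}` of a metric). -/
abbrev MatField (n : ℕ) : Type := Coord n → Matrix (Fin n) (Fin n) ℝ

section Local

variable {n : ℕ}

/-- The partial derivative `∂_i f` at `y`. -/
def pd (i : Fin n) (f : Coord n → ℝ) (y : Coord n) : ℝ :=
  fderiv ℝ f y (EuclideanSpace.single i 1)

/-- The scalar product `g_{ij} v^i w^j` at `y`. -/
def dot (G : MatField n) (y : Coord n) (v w : Fin n → ℝ) : ℝ :=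
  ∑ i, ∑ j, G y i j * v i * w j

/-- The Christoffel symbol `Γ^k_{ij}` of the Levi-Civita connection. -/
def christoffel (G : MatField n) (k i j : Fin n) (y : Coord n) : ℝ :=
  (1 / 2) * ∑ l, (G y)⁻¹ k l *
    (pd i (fun z => G z j l) y + pd j (fun z => G z i l) y - pd l (fun z => G z i j) y)

/-- The curvature `R_{ij}{}^k{}_l`, with
`(∇_i ∇_j - ∇_j ∇_i) v^k = R_{ij}{}^k{}_l v^l`. -/
def riemann (G : MatField n) (i j k l : Fin n) (y : Coord n) : ℝ :=
  pd i (christoffel G k j l) y - pd j (christoffel G k i l) y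
    + ∑ m, (christoffel G k i m y * christoffel G m j l y
        - christoffel G k j m y * christoffel G m i l y)

/-- The Ricci tensor `Ric_{ij} = R_{ki}{}^k{}_j`. -/
def ricci (G : MatField n) (i j : Fin n) (y : Coord n) : ℝ :=
  ∑ k, riemann G k i k j y

/-- The trace `J = g^{ij} P_{ij} = Scal / (2 (n - 1))` of the Schouten tensor. -/
def schoutenTrace (G : MatField n) (y : Coord n) : ℝ :=
  (∑ i, ∑ j, (G y)⁻¹ i j * ricci G i j y) / (2 * ((n : ℝ) - 1))

/-- The Schouten tensor `P_{ij}`, with `Ric_{ij} = (n - 2) P_{ij} + J g_{ij}` (for `n ≥ 3`). -/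
def schouten (G : MatField n) (i j : Fin n) (y : Coord n) : ℝ :=
  (ricci G i j y - schoutenTrace G y * G y i j) / ((n : ℝ) - 2)

/-- The Schouten tensor with the second index raised, `P_i{}^j`. -/
def schoutenUp (G : MatField n) (i j : Fin n) (y : Coord n) : ℝ :=
  ∑ l, (G y)⁻¹ j l * schouten G i l y

/-! ### Standard tractors in a scale

In the scale `g`, densities are functions, and the standard tractor bundle is
`E[1] ⊕ E^a[-1] ⊕ E[-1]`. -/

/-- A standard tractor `(σ, μ^a, ρ)` at a point, in a scale and in local coordinates. -/
abbrev Tractor (n : ℕ) : Type := ℝ × (Fin n → ℝ) × ℝ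

/-- The tractor metric `⟨(σ, μ, ρ), (τ, ν, π)⟩ = μ_a ν^a + σ π + ρ τ`. -/
def tractorMetric (G : MatField n) (y : Coord n) (V W : Tractor n) : ℝ :=
  dot G y V.2.1 W.2.1 + V.1 * W.2.2 + V.2.2 * W.1

/-- The standard tractor connection `∇_a` on tractor fields:
`∇_a (σ, μ^b, ρ) = (∇_a σ - μ_a, ∇_a μ^b + δ_a^b ρ + P_a{}^b σ, ∇_a ρ - P_{ac} μ^c)`. -/
def tractorNabla (G : MatField n) (a : Fin n) (V : Coord n → Tractor n) (y : Coord n) :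
    Tractor n :=
  (pd a (fun z => (V z).1) y - ∑ c, G y a c * (V y).2.1 c,
   fun b => pd a (fun z => (V z).2.1 b) y + ∑ c, christoffel G b a c y * (V y).2.1 c
      + (if a = b then (V y).2.2 else 0) + schoutenUp G a b y * (V y).1,
   pd a (fun z => (V z).2.2) y - ∑ c, schouten G a c y * (V y).2.1 c)

/-- The curvature `Ω_{ab}` of the tractor connection, as an endomorphism of the tractor fibre:
the commutator `∇_a ∇_b - ∇_b ∇_a` for the coordinate directions, applied to the tractor field
with constant components `V`. -/
def tractorCurvature (G : MatField n) (a b : Fin n) (y : Coord n) (V : Tractor n) : Tractor n :=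
  tractorNabla G a (tractorNabla G b (fun _ => V)) y
    - tractorNabla G b (tractorNabla G a (fun _ => V)) y

/-- The curvature as a 2-form with values in `Λ² T`: `Ω_{ab}(V, W) = ⟨V, Ω_{ab} W⟩`. -/
def tractorCurvatureForm (G : MatField n) (a b : Fin n) (y : Coord n) (V W : Tractor n) : ℝ :=
  tractorMetric G y V (tractorCurvature G a b y W)

/-! ### Vector fields and their adjoint tractors -/

/-- The covariant derivative `∇_a k^b` of a vector field. -/
def nablaVec (G : MatField n) (k : Coord n → Fin n → ℝ) (a b : Fin n) (y : Coord n) : ℝ :=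
  pd a (fun z => k z b) y + ∑ c, christoffel G b a c y * k y c

/-- `∇_a k_b`. -/
def nablaVecLow (G : MatField n) (k : Coord n → Fin n → ℝ) (a b : Fin n) (y : Coord n) : ℝ :=
  ∑ c, G y b c * nablaVec G k a c y

/-- The divergence `∇_c k^c`. -/
def divergence (G : MatField n) (k : Coord n → Fin n → ℝ) (y : Coord n) : ℝ :=
  ∑ c, nablaVec G k c c y

/-- The covariant derivative `∇_a m_{bc}` of a covariant 2-tensor. -/
def nablaForm (G : MatField n) (m : Fin n → Fin n → Coord n → ℝ) (a b c : Fin n)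
    (y : Coord n) : ℝ :=
  pd a (m b c) y - ∑ d, christoffel G d a b y * m d c y - ∑ d, christoffel G d a c y * m b d y

/-- An element of `Λ² T` in a scale, with slots `k^a` (the projecting one), `m_{ab}` (skew), `φ`
and `r_a`. -/
structure TwoTractor (n : ℕ) where
  vec : Fin n → ℝ
  skew : Fin n → Fin n → ℝ
  scal : ℝ
  form : Fin n → ℝ

/-- The value of an element of `Λ² T` on two standard tractors. It is `⟨S V, W⟩`, where `S` is the
skew endomorphism
`S (σ, μ^a, ρ) = (φ σ - k_c μ^c, σ r^a + m^a{}_c μ^c + ρ k^a, - φ ρ - r_c μ^c)`. -/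
def TwoTractor.eval (K : TwoTractor n) (G : MatField n) (y : Coord n) (V W : Tractor n) : ℝ :=
  K.scal * (V.1 * W.2.2 - V.2.2 * W.1)
    + V.2.2 * dot G y K.vec W.2.1 - W.2.2 * dot G y K.vec V.2.1
    + V.1 * (∑ a, K.form a * W.2.1 a) - W.1 * (∑ a, K.form a * V.2.1 a)
    + ∑ a, ∑ b, K.skew a b * W.2.1 a * V.2.1 b

/-- The skew slot `m_{ab} = ∇_{[b} k_{a]}` of the splitting operator. -/
def splitSkew (G : MatField n) (k : Coord n → Fin n → ℝ) (a b : Fin n) (y : Coord n) : ℝ :=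
  (nablaVecLow G k b a y - nablaVecLow G k a b y) / 2

/-- The scalar slot `φ = (1/n) ∇_c k^c` of the splitting operator. -/
def splitScal (G : MatField n) (k : Coord n → Fin n → ℝ) (y : Coord n) : ℝ :=
  divergence G k y / (n : ℝ)

/-- The last slot of the splitting operator,
`r_b = (1/n) (∇_b φ - ∇^a m_{ba} + 2 P_{bc} k^c - J k_b)`.
(If `k` is a conformal Killing field, this equals `∇_b φ + P_{bc} k^c`.) -/
def splitForm (G : MatField n) (k : Coord n → Fin n → ℝ) (b : Fin n) (y : Coord n) : ℝ :=
  (pd b (splitScal G k) y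
    - ∑ a, ∑ c, (G y)⁻¹ a c * nablaForm G (splitSkew G k) c b a y
    + 2 * ∑ c, schouten G b c y * k y c
    - schoutenTrace G y * ∑ c, G y b c * k y c) / (n : ℝ)

/-- The BGG splitting operator `L : E^a → Λ² T`. It is the differential operator with projecting
slot `k^a` and `∂^*(∇ L(k)) = 0`, where `∂^*` is the Kostant codifferential: the slots `m` and `φ`
make the skew part and the trace of the projecting slot `∇_a k_c + m_{ac} - φ g_{ac}` of
`∇_a L(k)` vanish, and `r` makes the `φ`-slot of `∇_b L(k)` equal to the contraction
`(∇^a L(k))_{ba}` of the `m`-slot. -/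
def splitting (G : MatField n) (k : Coord n → Fin n → ℝ) (y : Coord n) : TwoTractor n where
  vec := k y
  skew := fun a b => splitSkew G k a b y
  scal := splitScal G k y
  form := fun b => splitForm G k b y

/-! ### Curves in coordinates -/

/-- The tangent vector `U^a` of a curve. -/
def vel (x : ℝ → Coord n) (t : ℝ) : Fin n → ℝ := fun a => deriv (fun s => x s a) t

/-- The derivative `U^c ∇_c v^b` of a vector field `v` along a curve. -/
def ddtVec (G : MatField n) (x : ℝ → Coord n) (v : ℝ → Fin n → ℝ) (t : ℝ) : Fin n → ℝ :=
  fun b => deriv (fun s => v s b) t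
    + ∑ a, ∑ c, christoffel G b a c (x t) * vel x t a * v t c

/-- The acceleration `U'^a`. -/
def acc (G : MatField n) (x : ℝ → Coord n) : ℝ → Fin n → ℝ := ddtVec G x (vel x)

/-- The vector `U''^a`. -/
def jerk (G : MatField n) (x : ℝ → Coord n) : ℝ → Fin n → ℝ := ddtVec G x (acc G x)

/-- The tractor derivative `U^c ∇_c V` of a tractor field `V` along a curve. -/
def ddtTractor (G : MatField n) (x : ℝ → Coord n) (V : ℝ → Tractor n) (t : ℝ) : Tractor n :=
  (deriv (fun s => (V s).1) t - dot G (x t) (vel x t) (V t).2.1,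
   fun b => deriv (fun s => (V s).2.1 b) t
      + (∑ a, ∑ c, christoffel G b a c (x t) * vel x t a * (V t).2.1 c)
      + vel x t b * (V t).2.2 + (∑ a, vel x t a * schoutenUp G a b (x t)) * (V t).1,
   deriv (fun s => (V s).2.2) t
      - ∑ a, ∑ c, schouten G a c (x t) * vel x t a * (V t).2.1 c)

/-- The density `u = √|U_c U^c|`. -/
def speed (G : MatField n) (x : ℝ → Coord n) (t : ℝ) : ℝ :=
  Real.sqrt |dot G (x t) (vel x t) (vel x t)|

/-- The canonical lift `T = (0, 0, u⁻¹)` of the curve to the tractor bundle. -/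
def tractorT (G : MatField n) (x : ℝ → Coord n) (t : ℝ) : Tractor n :=
  (0, 0, (speed G x t)⁻¹)

/-- The tractor `U = d/dt T`. -/
def tractorU (G : MatField n) (x : ℝ → Coord n) : ℝ → Tractor n := ddtTractor G x (tractorT G x)

/-- The tractor `U' = d/dt U`. -/
def tractorU' (G : MatField n) (x : ℝ → Coord n) : ℝ → Tractor n := ddtTractor G x (tractorU G x)

/-- The equation of conformal circles with an arbitrary parameter,
`U^{[a} U''^{b]} = 3 (U_c U^c)⁻¹ U_d U'^d U^{[a} U'^{b]} + (U_c U^c) U^{[a} P^{b]}{}_d U^d`. -/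
def CircleEquation (G : MatField n) (x : ℝ → Coord n) (t : ℝ) : Prop :=
  let U := vel x t
  let U₁ := acc G x t
  let N := dot G (x t) U U
  let Z : Fin n → ℝ := fun b => jerk G x t b - 3 * N⁻¹ * dot G (x t) U U₁ * U₁ b
    - N * ∑ d, U d * schoutenUp G d b (x t)
  ∀ a b, U a * Z b = U b * Z a

/-- The 1-form `ℓ_a = U^b Ω_{ab}(U, U')` along a curve. -/
def ellForm (G : MatField n) (x : ℝ → Coord n) (t : ℝ) (a : Fin n) : ℝ :=
  ∑ b, vel x t b * tractorCurvatureForm G a b (x t) (tractorU G x t) (tractorU' G x t)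

end Local

/-! ### Conformal manifolds -/

/-- A smooth pseudo-Riemannian metric (of any signature) on an `n`-manifold `M`. -/
structure PseudoMetric (n : ℕ) (M : Type*) [TopologicalSpace M] [ChartedSpace (Coord n) M]
    [IsManifold (𝓡 n) ∞ M] where
  inner : ∀ x : M, TangentSpace (𝓡 n) x →L[ℝ] TangentSpace (𝓡 n) x →L[ℝ] ℝ
  symm : ∀ (x : M) (v w : TangentSpace (𝓡 n) x), inner x v w = inner x w v
  nondeg : ∀ (x : M) (v : TangentSpace (𝓡 n) x), (∀ w, inner x v w = 0) → v = 0
  contMDiff : ContMDiff (𝓡 n) ((𝓡 n).prod 𝓘(ℝ, Coord n →L[ℝ] Coord n →L[ℝ] ℝ)) ∞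
    (fun x : M => Bundle.TotalSpace.mk' (Coord n →L[ℝ] Coord n →L[ℝ] ℝ)
      (E := fun x : M => TangentSpace (𝓡 n) x →L[ℝ] TangentSpace (𝓡 n) x →L[ℝ] ℝ) x (inner x))

section Global

variable {n : ℕ} {M : Type*} [TopologicalSpace M] [ChartedSpace (Coord n) M]
  [IsManifold (𝓡 n) ∞ M]

/-- Two metrics are conformally related if they differ by an everywhere positive function. -/
def ConformallyRelated (g h : PseudoMetric n M) : Prop :=
  ∃ f : M → ℝ, ContMDiff (𝓡 n) 𝓘(ℝ, ℝ) ∞ f ∧ (∀ x, 0 < f x) ∧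
    ∀ (x : M) (v w : TangentSpace (𝓡 n) x), h.inner x v w = f x * g.inner x v w

variable (n M) in
/-- A conformal structure: a conformal class of metrics. Its elements are the scales. -/
structure ConformalStructure where
  scales : Set (PseudoMetric n M)
  nonempty : scales.Nonempty
  mem_iff : ∀ g ∈ scales, ∀ h, h ∈ scales ↔ ConformallyRelated g h

variable (n M) in
/-- The smooth coordinate charts of `M`. -/
abbrev charts : Set (OpenPartialHomeomorph M (Coord n)) := IsManifold.maximalAtlas (𝓡 n) ∞ M

/-- The components `g_{ij}` of a metric in a chart. -/
def PseudoMetric.comp (g : PseudoMetric n M) (e : OpenPartialHomeomorph M (Coord n)) :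
    MatField n :=
  fun y => Matrix.of fun i j => g.inner (e.symm y)
    (mfderiv (𝓡 n) (𝓡 n) e.symm y (EuclideanSpace.single i (1 : ℝ) : Coord n))
    (mfderiv (𝓡 n) (𝓡 n) e.symm y (EuclideanSpace.single j (1 : ℝ) : Coord n))

/-- The components `k^i` of a vector field in a chart. -/
def vecComp (k : ∀ x : M, TangentSpace (𝓡 n) x) (e : OpenPartialHomeomorph M (Coord n)) :
    Coord n → Fin n → ℝ :=
  fun y i =>
    let v : Coord n := mfderiv (𝓡 n) (𝓡 n) e (e.symm y) (k (e.symm y))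
    v i

/-- The coordinate expression of a curve in a chart. -/
def curveComp (γ : ℝ → M) (e : OpenPartialHomeomorph M (Coord n)) : ℝ → Coord n :=
  fun t => e (γ t)

/-- `k` is a conformal Killing field: the trace-free part of `∇_{(a} k_{b)}` vanishes. -/
def IsConformalKilling (g : PseudoMetric n M) (k : ∀ x : M, TangentSpace (𝓡 n) x) : Prop :=
  ∀ e ∈ charts n M, ∀ y ∈ e.target, ∀ a b : Fin n,
    (nablaVecLow (g.comp e) (vecComp k e) a b y + nablaVecLow (g.comp e) (vecComp k e) b a y) / 2
      = divergence (g.comp e) (vecComp k e) y / (n : ℝ) * g.comp e y a b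

/-- The curve is nowhere null on `J` (in positive definite signature: it is regular). -/
def IsNowhereNull (g : PseudoMetric n M) (γ : ℝ → M) (J : Set ℝ) : Prop :=
  ∀ e ∈ charts n M, ∀ t ∈ J, γ t ∈ e.source →
    dot (g.comp e) (curveComp γ e t) (vel (curveComp γ e) t) (vel (curveComp γ e) t) ≠ 0

/-- The curve is a conformal circle on `J` (with an arbitrary parametrization). -/
def IsConformalCircle (g : PseudoMetric n M) (γ : ℝ → M) (J : Set ℝ) : Prop :=
  ∀ e ∈ charts n M, ∀ t ∈ J, γ t ∈ e.source → CircleEquation (g.comp e) (curveComp γ e) t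

/-- The parameter of the curve is projective on `J`: `⟨U', U'⟩ = 0`. -/
def IsProjectiveParameter (g : PseudoMetric n M) (γ : ℝ → M) (J : Set ℝ) : Prop :=
  ∀ e ∈ charts n M, ∀ t ∈ J, γ t ∈ e.source →
    tractorMetric (g.comp e) (curveComp γ e t) (tractorU' (g.comp e) (curveComp γ e) t)
      (tractorU' (g.comp e) (curveComp γ e) t) = 0

/-- `k^a ℓ_a = 0` along the curve. -/
def AnnihilatesEll (g : PseudoMetric n M) (γ : ℝ → M) (J : Set ℝ)
    (k : ∀ x : M, TangentSpace (𝓡 n) x) : Prop :=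
  ∀ e ∈ charts n M, ∀ t ∈ J, γ t ∈ e.source →
    ∑ a, vecComp k e (curveComp γ e t) a * ellForm (g.comp e) (curveComp γ e) t a = 0

/-- The function `𝔨 = K(U, U')` along the curve, where `K = L(k)`, computed in a chart. -/
def conserved (g : PseudoMetric n M) (γ : ℝ → M) (k : ∀ x : M, TangentSpace (𝓡 n) x)
    (e : OpenPartialHomeomorph M (Coord n)) (t : ℝ) : ℝ :=
  (splitting (g.comp e) (vecComp k e) (curveComp γ e t)).eval (g.comp e) (curveComp γ e t)
    (tractorU (g.comp e) (curveComp γ e) t) (tractorU' (g.comp e) (curveComp γ e) t)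

end Global

end ConformalTractor

end

/-! The derivative of `K(U, U')` along the curve has three contributions: `K(U', U')`, `K(U, U'')`
and `(∇_U K)(U, U')`. The first vanishes because `K` is skew, the second because `U'' = 0`, and the
third equals `k^a ℓ_a`, which is zero by assumption.

The vanishing of `U''` is `LocalCurve.ddtTractor_tractorU'`. The function `⟨U, U⟩ = ±1` is constant,
so `⟨U, U'⟩ = 0`, and `⟨U', U'⟩ = 0` by the choice of parameter. Differentiating these relations,
together with `⟨T, U'⟩ = -⟨U, U⟩`, shows that `U''` is orthogonal to `T`, `U` and `U'`. The circle
equation says that the middle slot of `U''` is proportional to the velocity, and for a tractor of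
this shape the three orthogonality relations kill the three slots one after another.

The third contribution comes from the prolonged conformal Killing equation: `∇_a S = k^b Ω_{ab}` for
the skew endomorphism `S` (`FormalMetric.IsKilling.nablaT_endoT`), hence `∇_a K = -k^b Ω_{ab}`
(`FormalMetric.IsKilling.d_evalT`). The infinitesimal flow of `k` preserves the conformal structure,
so it acts on tractors by a Lie derivative `L_k` that commutes with the tractor connection
(`IsKilling.lieT_nablaT`). Since `S = ∇_k - L_k` is algebraic (`endoT_eq`), commuting `∇_a` past it
leaves only the curvature. The commutation rests on three Lie derivatives: `L_k g = 2φ g`, `L_k Γ`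
of the form of an infinitesimal conformal change (`IsKilling.lieChr_eq`), and `L_k P = -∇∇φ`
(`IsKilling.along_sch`), the last obtained by contracting `L_k R`. That `S` really is the image
under the splitting operator requires `r = dφ + P k` (`IsKilling.formSlot_eq`).

All tensor identities are proved over a commutative algebra with commuting derivations, where no
differentiability conditions arise. They are then evaluated in the algebra of smooth functions on
the image of a chart. -/

noncomputable section

namespace ConformalTractor

/-! ### Derivations acting entrywise on matrices. -/

section MatrixDerivation

open Matrix

variable {R : Type*} [CommRing R] [Algebra ℝ R] {ι κ ν : Type*}

/-- A derivation applied to the entries of a matrix. -/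
def mapD (D : Derivation ℝ R R) (M : Matrix ι κ R) : Matrix ι κ R := M.map D

theorem mapD_apply (D : Derivation ℝ R R) (M : Matrix ι κ R) (i : ι) (j : κ) :
    mapD D M i j = D (M i j) := rfl

theorem mapD_add (D : Derivation ℝ R R) (M N : Matrix ι κ R) :
    mapD D (M + N) = mapD D M + mapD D N := by
  ext i j; simp [mapD]

theorem mapD_sub (D : Derivation ℝ R R) (M N : Matrix ι κ R) :
    mapD D (M - N) = mapD D M - mapD D N := by
  ext i j; simp [mapD]

theorem mapD_sum {α : Type*} (D : Derivation ℝ R R) (s : Finset α) (M : α → Matrix ι κ R) :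
    mapD D (∑ a ∈ s, M a) = ∑ a ∈ s, mapD D (M a) := by
  ext i j; simp [mapD, Matrix.sum_apply]

theorem mapD_smul (D : Derivation ℝ R R) (f : R) (M : Matrix ι κ R) :
    mapD D (f • M) = D f • M + f • mapD D M := by
  ext i j; simp [mapD]; ring

theorem mapD_mul [Fintype κ] (D : Derivation ℝ R R) (M : Matrix ι κ R) (N : Matrix κ ν R) :
    mapD D (M * N) = mapD D M * N + M * mapD D N := by
  ext i j
  simp only [mapD, Matrix.map_apply, Matrix.mul_apply, Matrix.add_apply, map_sum,
    Derivation.leibniz, smul_eq_mul, ← Finset.sum_add_distrib]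
  exact Finset.sum_congr rfl fun _ _ => by ring

theorem mapD_transpose (D : Derivation ℝ R R) (M : Matrix ι κ R) :
    mapD D Mᵀ = (mapD D M)ᵀ := rfl

theorem mapD_one [DecidableEq ι] (D : Derivation ℝ R R) :
    mapD D (1 : Matrix ι ι R) = 0 := by
  ext i j; by_cases h : i = j <;> simp [mapD, h]

theorem mapD_trace [Fintype ι] (D : Derivation ℝ R R) (M : Matrix ι ι R) :
    D M.trace = (mapD D M).trace := by
  simp [Matrix.trace, mapD]

end MatrixDerivation

theorem half_add_half_mul {R : Type*} [CommRing R] [Algebra ℝ R] (a : R) :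
    2 * ((1 / 2 : ℝ) • a) = a := by
  rw [mul_smul_comm, two_mul, ← two_smul ℝ a, smul_smul]; norm_num

/-- The ring may have zero divisors, but 2 is invertible in every real algebra. -/
theorem eq_of_two_mul_eq {R : Type*} [CommRing R] [Algebra ℝ R] {a b : R}
    (h : 2 * a = 2 * b) : a = b := by
  rw [← half_add_half_mul a, ← half_add_half_mul b, mul_smul_comm, mul_smul_comm, h]

/-! ### Levi-Civita connection, curvature and Schouten tensor over an algebra with derivations. -/

/-- A metric with components in an algebra `R` with commuting derivations `∂_1, …, ∂_n`: an
algebraic model of a metric in local coordinates. -/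
structure FormalMetric (n : ℕ) (R : Type*) [CommRing R] [Algebra ℝ R] where
  d : Fin n → Derivation ℝ R R
  comm : ∀ i j f, d i (d j f) = d j (d i f)
  g : Matrix (Fin n) (Fin n) R
  h : Matrix (Fin n) (Fin n) R
  symm : g.transpose = g
  mul_inv : g * h = 1

namespace FormalMetric

open Matrix

variable {n : ℕ} {R : Type*} [CommRing R] [Algebra ℝ R] (A : FormalMetric n R)

theorem inv_mul : A.h * A.g = 1 := mul_eq_one_comm.mp A.mul_inv

theorem g_swap (i j : Fin n) : A.g i j = A.g j i := congrFun (congrFun A.symm j) i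

theorem h_symm : A.hᵀ = A.h := by
  have h1 : A.hᵀ * A.g = 1 := by
    have := congrArg Matrix.transpose A.mul_inv
    rwa [Matrix.transpose_mul, A.symm, Matrix.transpose_one] at this
  calc A.hᵀ = A.hᵀ * (A.g * A.h) := by rw [A.mul_inv, Matrix.mul_one]
    _ = A.h := by rw [← Matrix.mul_assoc, h1, Matrix.one_mul]

theorem h_swap (i j : Fin n) : A.h i j = A.h j i := congrFun (congrFun A.h_symm j) i

theorem comm_mapD (i j : Fin n) {ι κ : Type*} (M : Matrix ι κ R) :
    mapD (A.d i) (mapD (A.d j) M) = mapD (A.d j) (mapD (A.d i) M) := by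
  ext a b; exact A.comm i j _

/-- The matrix `(Γ_i)^k_j` of Christoffel symbols. -/
def chr (i : Fin n) : Matrix (Fin n) (Fin n) R := Matrix.of fun k j =>
  (1 / 2 : ℝ) • ∑ l, A.h k l * (A.d i (A.g j l) + A.d j (A.g i l) - A.d l (A.g i j))

theorem chr_swap (i j k : Fin n) : A.chr i k j = A.chr j k i := by
  simp only [chr, Matrix.of_apply]
  congr 1
  refine Finset.sum_congr rfl fun l _ => ?_
  rw [A.g_swap i j]; ring

/-- Lowering the upper index cancels the inverse metric and leaves the Christoffel symbols of the
first kind. -/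
theorem two_mul_g_chr (i l j : Fin n) :
    2 * (A.g * A.chr i) l j = A.d i (A.g j l) + A.d j (A.g i l) - A.d l (A.g i j) := by
  have h1 : 2 * (A.g * A.chr i) l j
      = (A.g *ᵥ (A.h *ᵥ fun l => A.d i (A.g j l) + A.d j (A.g i l) - A.d l (A.g i j))) l := by
    simp only [Matrix.mul_apply, Matrix.mulVec, dotProduct, Finset.mul_sum, chr, Matrix.of_apply]
    refine Finset.sum_congr rfl fun c _ => ?_
    rw [mul_left_comm, half_add_half_mul, Finset.mul_sum]
  rw [h1, Matrix.mulVec_mulVec, A.mul_inv, Matrix.one_mulVec]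

/-- The Levi-Civita connection is metric. -/
theorem d_g (i : Fin n) : mapD (A.d i) A.g = A.g * A.chr i + (A.chr i)ᵀ * A.g := by
  ext a b
  have h1 : ((A.chr i)ᵀ * A.g) a b = (A.g * A.chr i) b a := by
    rw [← Matrix.transpose_apply (A.g * A.chr i), Matrix.transpose_mul, A.symm]
  apply eq_of_two_mul_eq
  rw [Matrix.add_apply, h1, mul_add, A.two_mul_g_chr, A.two_mul_g_chr, mapD_apply,
    A.g_swap b a, A.g_swap i a, A.g_swap i b]
  ring

theorem d_h (D : Derivation ℝ R R) : mapD D A.h = -(A.h * mapD D A.g * A.h) := by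
  have h1 := congrArg (mapD D) A.mul_inv
  rw [mapD_mul, mapD_one] at h1
  have h2 := congrArg (fun M => A.h * M) h1
  simp only [Matrix.mul_add, ← Matrix.mul_assoc, A.inv_mul, Matrix.one_mul, Matrix.mul_zero] at h2
  exact eq_neg_of_add_eq_zero_right h2

/-- The matrix `(R_{ij})^k_l` of the curvature. -/
def rm (i j : Fin n) : Matrix (Fin n) (Fin n) R :=
  mapD (A.d i) (A.chr j) - mapD (A.d j) (A.chr i) + (A.chr i * A.chr j - A.chr j * A.chr i)

theorem rm_swap (i j : Fin n) : A.rm i j = -A.rm j i := by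
  simp only [rm]; abel

/-- The derivatives `∂_i ∂_j g` and `∂_j ∂_i g` agree. Expanding both by metricity of the
connection, the difference is exactly the curvature acting on `g`. -/
theorem rm_skew (i j : Fin n) : A.g * A.rm i j + (A.rm i j)ᵀ * A.g = 0 := by
  have h1 := A.comm_mapD i j A.g
  simp only [d_g, mapD_add, mapD_mul, mapD_transpose] at h1
  simp only [rm, Matrix.transpose_add, Matrix.transpose_sub, Matrix.transpose_mul]
  rw [← sub_eq_zero] at h1
  rw [← h1]
  noncomm_ring

theorem trace_rm (i j : Fin n) : (A.rm i j).trace = 0 := by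
  have h1 : A.g * A.rm i j = -((A.rm i j)ᵀ * A.g) := eq_neg_of_add_eq_zero_left (A.rm_skew i j)
  have h2 : (A.rm i j).trace = -(A.rm i j).trace := by
    calc (A.rm i j).trace = (A.h * (A.g * A.rm i j)).trace := by
          rw [← Matrix.mul_assoc, A.inv_mul, Matrix.one_mul]
      _ = -((A.rm i j)ᵀ * (A.g * A.h)).trace := by
          rw [h1, Matrix.mul_neg, Matrix.trace_neg, Matrix.trace_mul_comm, Matrix.mul_assoc]
      _ = -(A.rm i j).trace := by rw [A.mul_inv, Matrix.mul_one, Matrix.trace_transpose]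
  apply eq_of_two_mul_eq
  linear_combination h2

/-- The first Bianchi identity. -/
theorem bianchi (i j l k : Fin n) : A.rm i j k l + A.rm j l k i + A.rm l i k j = 0 := by
  simp only [rm, Matrix.add_apply, Matrix.sub_apply, Matrix.mul_apply, mapD_apply]
  simp only [A.chr_swap l i, A.chr_swap l j, A.chr_swap j i]
  ring

/-- The Ricci tensor. -/
def ric : Matrix (Fin n) (Fin n) R := Matrix.of fun j l => ∑ k, A.rm k j k l

theorem ric_apply (j l : Fin n) : A.ric j l = ∑ k, A.rm k j k l := rfl

/-- Contract the first Bianchi identity. The term in which the trace is over the endomorphism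
indices drops out by `trace_rm`. -/
theorem ric_swap (j l : Fin n) : A.ric j l = A.ric l j := by
  have h1 : ∑ k, (A.rm k j k l + A.rm j l k k + A.rm l k k j) = 0 :=
    Finset.sum_eq_zero fun k _ => A.bianchi k j l k
  have h2 : ∑ k, A.rm j l k k = 0 := A.trace_rm j l
  have h3 : ∑ k, A.rm l k k j = - ∑ k, A.rm k l k j := by
    rw [← Finset.sum_neg_distrib]
    exact Finset.sum_congr rfl fun k _ => by rw [A.rm_swap l k]; rfl
  rw [Finset.sum_add_distrib, Finset.sum_add_distrib, h2, h3] at h1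
  rw [ric_apply, ric_apply]
  linear_combination h1

theorem ric_symm : A.ricᵀ = A.ric := by ext j l; exact A.ric_swap l j

/-- The scalar curvature. -/
def scal : R := (A.h * A.ric).trace

/-- The trace of the Schouten tensor. -/
def jt : R := (2 * ((n : ℝ) - 1))⁻¹ • A.scal

/-- The Schouten tensor. -/
def sch : Matrix (Fin n) (Fin n) R := ((n : ℝ) - 2)⁻¹ • (A.ric - A.jt • A.g)

theorem sch_symm : A.schᵀ = A.sch := by
  simp [sch, A.ric_symm, A.symm]

theorem sch_swap (i j : Fin n) : A.sch i j = A.sch j i := congrFun (congrFun A.sch_symm j) i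

theorem ric_eq (hn : 3 ≤ n) : A.ric = ((n : R) - 2) • A.sch + A.jt • A.g := by
  have h0 : (n : ℝ) - 2 ≠ 0 := by
    have : (3 : ℝ) ≤ n := by exact_mod_cast hn
    linarith
  have h1 : ((n : R) - 2) • A.sch = ((n : ℝ) - 2) • A.sch := by
    rw [← algebraMap_smul R ((n : ℝ) - 2), map_sub, map_natCast, map_ofNat]
  rw [h1, sch, smul_smul, mul_inv_cancel₀ h0, one_smul]; abel

/-! ### Vector fields -/

variable (k : Fin n → R)

/-- The derivative in the direction of `k`. -/
def along : Derivation ℝ R R := ∑ i, k i • A.d i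

theorem along_apply (f : R) : A.along k f = ∑ i, k i * A.d i f := by
  rw [along, ← Derivation.coeFnAddMonoidHom_apply, map_sum, Finset.sum_apply]
  simp [Derivation.coeFnAddMonoidHom_apply]

/-- The matrix `∂_b k^c` of partial derivatives. -/
def jac : Matrix (Fin n) (Fin n) R := Matrix.of fun c b => A.d b (k c)

theorem mapD_along {ι κ : Type*} (M : Matrix ι κ R) :
    mapD (A.along k) M = ∑ i, k i • mapD (A.d i) M := by
  ext a b; simp [mapD_apply, along_apply, Matrix.sum_apply]

/-- The commutator `[k, ∂_i] = -(∂_i k^b) ∂_b` supplies the Jacobian terms of all the Lie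
derivatives below. -/
theorem along_comm (i : Fin n) (f : R) :
    A.along k (A.d i f) = A.d i (A.along k f) - ∑ b, A.d i (k b) * A.d b f := by
  simp only [along_apply, map_sum, Derivation.leibniz, smul_eq_mul, ← Finset.sum_sub_distrib]
  exact Finset.sum_congr rfl fun b _ => by rw [A.comm i b]; ring

theorem along_comm_mapD (i : Fin n) {ι κ : Type*} (M : Matrix ι κ R) :
    mapD (A.along k) (mapD (A.d i) M)
      = mapD (A.d i) (mapD (A.along k) M) - ∑ b, A.d i (k b) • mapD (A.d b) M := by
  ext a b; simp [mapD_apply, A.along_comm k i, Matrix.sum_apply]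

/-- The matrix `∇_b k^c`. -/
def nab : Matrix (Fin n) (Fin n) R := A.jac k + ∑ b, k b • A.chr b

/-- Rows carry the vector index and columns the differentiation index. Torsion-freeness reconciles
this with the definition, which contracts `k` with the other lower index. -/
theorem nab_apply (c a : Fin n) : A.nab k c a = A.d a (k c) + ∑ b, A.chr a c b * k b := by
  simp only [nab, jac, Matrix.add_apply, Matrix.of_apply, Matrix.sum_apply, Matrix.smul_apply,
    smul_eq_mul]
  congr 1
  exact Finset.sum_congr rfl fun b _ => by rw [A.chr_swap b a]; ring

/-- The Lie derivative of the Christoffel symbols. -/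
def lieChr (i : Fin n) : Matrix (Fin n) (Fin n) R :=
  mapD (A.along k) (A.chr i) + ∑ b, A.d i (k b) • A.chr b
    + (A.chr i * A.jac k - A.jac k * A.chr i) + mapD (A.d i) (A.jac k)

/-- Symmetry is inherited from that of the Christoffel symbols, and for the second derivatives of
`k` from commuting partial derivatives. -/
theorem lieChr_swap (i j c : Fin n) : A.lieChr k i c j = A.lieChr k j c i := by
  simp only [lieChr, Matrix.add_apply, Matrix.sub_apply, Matrix.mul_apply, mapD_apply, jac,
    Matrix.of_apply, Matrix.sum_apply, Matrix.smul_apply, smul_eq_mul]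
  rw [A.chr_swap i j c, A.comm i j]
  have h1 (i j : Fin n) : ∑ x, A.chr i c x * (A.d j) (k x) = ∑ x, A.d j (k x) * A.chr x c i :=
    Finset.sum_congr rfl fun x _ => by rw [A.chr_swap i x]; ring
  have h2 : ∑ x, A.d x (k c) * A.chr i x j = ∑ x, A.d x (k c) * A.chr j x i :=
    Finset.sum_congr rfl fun x _ => by rw [A.chr_swap i j]
  rw [h1, h1, h2]
  ring

/-- The second covariant derivative of `k` splits into the variation of the connection and a
curvature term. It is the bridge from the Killing equation to `lieChr`. -/
theorem nabla_nab (i : Fin n) :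
    mapD (A.d i) (A.nab k) + (A.chr i * A.nab k - A.nab k * A.chr i)
      = A.lieChr k i + ∑ b, k b • A.rm i b := by
  have h1 : ∑ b, k b • A.rm i b = ∑ b, k b • mapD (A.d i) (A.chr b)
      - mapD (A.along k) (A.chr i)
      + (A.chr i * (∑ b, k b • A.chr b) - (∑ b, k b • A.chr b) * A.chr i) := by
    simp only [rm, A.mapD_along k, Finset.mul_sum, Finset.sum_mul, Matrix.mul_smul,
      Matrix.smul_mul, ← Finset.sum_sub_distrib, ← Finset.sum_add_distrib, smul_sub, smul_add]
  rw [h1, lieChr, nab, mapD_add, mapD_sum]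
  simp only [mapD_smul, Finset.sum_add_distrib]
  noncomm_ring

end FormalMetric

/-! ### Lie derivatives of connection, curvature and Schouten tensor along a conformal Killing
field. -/

namespace FormalMetric

open Matrix

variable {n : ℕ} {R : Type*} [CommRing R] [Algebra ℝ R] (A : FormalMetric n R) (k : Fin n → R)

/-- The conformal Killing equation `∇_a k_b + ∇_b k_a = 2 φ g_{ab}`. -/
def IsKilling (φ : R) : Prop :=
  A.g * A.nab k + (A.nab k)ᵀ * A.g = (2 * φ) • A.g

/-- The Lie derivative of the curvature is the exterior covariant derivative of the Lie derivative
of the connection. -/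
theorem lie_rm (i j : Fin n) :
    mapD (A.along k) (A.rm i j) + ∑ b, A.d i (k b) • A.rm b j + ∑ b, A.d j (k b) • A.rm i b
        + (A.rm i j * A.jac k - A.jac k * A.rm i j)
      = mapD (A.d i) (A.lieChr k j) + (A.chr i * A.lieChr k j - A.lieChr k j * A.chr i)
        - (mapD (A.d j) (A.lieChr k i) + (A.chr j * A.lieChr k i - A.lieChr k i * A.chr j)) := by
  have h1 : ∑ b, A.d i (k b) • A.rm b j
      = ∑ b, A.d i (k b) • mapD (A.d b) (A.chr j) - ∑ b, A.d i (k b) • mapD (A.d j) (A.chr b)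
        + ((∑ b, A.d i (k b) • A.chr b) * A.chr j - A.chr j * ∑ b, A.d i (k b) • A.chr b) := by
    simp only [rm, Finset.mul_sum, Finset.sum_mul, Matrix.mul_smul,
      Matrix.smul_mul, ← Finset.sum_sub_distrib, ← Finset.sum_add_distrib, smul_sub, smul_add]
  have h2 : ∑ b, A.d j (k b) • A.rm i b
      = ∑ b, A.d j (k b) • mapD (A.d i) (A.chr b) - ∑ b, A.d j (k b) • mapD (A.d b) (A.chr i)
        + (A.chr i * (∑ b, A.d j (k b) • A.chr b) - (∑ b, A.d j (k b) • A.chr b) * A.chr i) := by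
    simp only [rm, Finset.mul_sum, Finset.sum_mul, Matrix.mul_smul,
      Matrix.smul_mul, ← Finset.sum_sub_distrib, ← Finset.sum_add_distrib, smul_sub, smul_add]
  have h3 (i j : Fin n) : mapD (A.d i) (∑ b, A.d j (k b) • A.chr b)
      = ∑ b, A.d i (A.d j (k b)) • A.chr b + ∑ b, A.d j (k b) • mapD (A.d i) (A.chr b) := by
    simp only [mapD_sum, mapD_smul, Finset.sum_add_distrib]
  have h4 : ∑ b, A.d i (A.d j (k b)) • A.chr b = ∑ b, A.d j (A.d i (k b)) • A.chr b := by
    simp only [A.comm i j]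
  -- The terms with second derivatives of `k` contracted with `Γ` are symmetric in `i` and `j` and
  -- cancel by `h4`; the rest is a noncommutative polynomial identity.
  rw [h1, h2]
  simp only [rm, lieChr, mapD_add, mapD_sub, mapD_mul, A.along_comm_mapD, h3]
  rw [h4, A.comm_mapD i j]
  noncomm_ring

variable {A k} {φ : R}

/-- Differentiate the Killing equation covariantly and replace `∇∇k` by `nabla_nab`. The curvature
part is skew after lowering an index, so it does not contribute. -/
theorem IsKilling.g_lieChr (hk : A.IsKilling k φ) (i : Fin n) :
    A.g * A.lieChr k i + (A.lieChr k i)ᵀ * A.g = (2 * A.d i φ) • A.g := by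
  have h1 : A.lieChr k i = mapD (A.d i) (A.nab k) + (A.chr i * A.nab k - A.nab k * A.chr i)
      - ∑ b, k b • A.rm i b := by rw [A.nabla_nab]; abel
  have h2 : A.g * (∑ b, k b • A.rm i b) + (∑ b, k b • A.rm i b)ᵀ * A.g = 0 := by
    simp only [Matrix.transpose_sum, Matrix.transpose_smul, Finset.mul_sum, Finset.sum_mul,
      Matrix.mul_smul, Matrix.smul_mul, ← Finset.sum_add_distrib, ← smul_add, A.rm_skew, smul_zero,
      Finset.sum_const_zero]
  have h3 := congrArg (mapD (A.d i)) hk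
  have h4 : A.d i (2 * φ) = 2 * A.d i φ := by rw [two_mul, map_add, two_mul]
  simp only [mapD_add, mapD_mul, mapD_smul, mapD_transpose, A.d_g, h4] at h3
  have h5 : (2 * A.d i φ) • A.g = A.g * mapD (A.d i) (A.nab k)
      + (mapD (A.d i) (A.nab k))ᵀ * A.g + (A.g * A.chr i + (A.chr i)ᵀ * A.g) * A.nab k
      + (A.nab k)ᵀ * (A.g * A.chr i + (A.chr i)ᵀ * A.g)
      - ((A.g * A.nab k + (A.nab k)ᵀ * A.g) * A.chr i
        + (A.chr i)ᵀ * (A.g * A.nab k + (A.nab k)ᵀ * A.g)) := by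
    rw [hk, Matrix.smul_mul, Matrix.mul_smul, ← smul_add]
    rw [eq_sub_iff_add_eq, ← h3]
    abel
  rw [h5, h1]
  rw [Matrix.mul_sub, Matrix.transpose_sub, Matrix.sub_mul]
  rw [sub_add_sub_comm, h2, sub_zero]
  simp only [Matrix.transpose_add, Matrix.transpose_sub, Matrix.transpose_mul]
  noncomm_ring

/-- This is the Koszul argument: a 3-tensor symmetric in one pair of indices is determined by its
symmetrization in another pair, through a signed sum over three permutations. -/
theorem IsKilling.g_lieChr_apply (hk : A.IsKilling k φ) (i c j : Fin n) :
    (A.g * A.lieChr k i) c j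
      = A.d i φ * A.g c j + A.d j φ * A.g c i - A.d c φ * A.g i j := by
  have h1 (i c j : Fin n) : (A.g * A.lieChr k i) c j + (A.g * A.lieChr k i) j c
      = 2 * A.d i φ * A.g c j := by
    have := congrFun (congrFun (hk.g_lieChr i) c) j
    rwa [Matrix.add_apply, ← A.symm, ← Matrix.transpose_mul, Matrix.transpose_apply, A.symm,
      Matrix.smul_apply, smul_eq_mul] at this
  have h2 (i c j : Fin n) : (A.g * A.lieChr k i) c j = (A.g * A.lieChr k j) c i := by
    simp only [Matrix.mul_apply, A.lieChr_swap k i j]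
  apply eq_of_two_mul_eq
  have e1 := h1 i c j
  have e2 := h1 j c i
  have e3 := h1 c i j
  rw [A.g_swap c j] at e1 ⊢
  rw [A.g_swap c i] at e2 ⊢
  rw [A.g_swap i j] at e3 ⊢
  rw [h2 j c i] at e2
  rw [h2 i j c] at e1
  rw [h2 j i c] at e2
  linear_combination e1 + e2 - e3

variable (A φ) in
/-- The gradient of a function. -/
def grad : Fin n → R := A.h *ᵥ fun l => A.d l φ

/-- Raising the index shows that the connection varies along `k` as it does under the infinitesimal
rescaling of `g` by `2φ`. -/
theorem IsKilling.lieChr_eq (hk : A.IsKilling k φ) (i : Fin n) :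
    A.lieChr k i = A.d i φ • (1 : Matrix (Fin n) (Fin n) R)
      + vecMulVec (Pi.single i 1) (fun l => A.d l φ) - vecMulVec (A.grad φ) (A.g i) := by
  have h1 : A.g * A.lieChr k i = A.d i φ • A.g
      + vecMulVec (A.g *ᵥ Pi.single i 1) (fun l => A.d l φ)
      - vecMulVec (fun l => A.d l φ) (A.g i) := by
    ext c j
    rw [hk.g_lieChr_apply]
    simp [vecMulVec_apply]; ring
  calc A.lieChr k i = A.h * (A.g * A.lieChr k i) := by
        rw [← Matrix.mul_assoc, A.inv_mul, Matrix.one_mul]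
    _ = _ := by
        rw [h1, Matrix.mul_sub, Matrix.mul_add, Matrix.mul_smul, A.inv_mul, mul_vecMulVec,
          mul_vecMulVec, Matrix.mulVec_mulVec, A.inv_mul, Matrix.one_mulVec, grad]

variable (A φ) in
/-- The covariant Hessian of a function. -/
def hess : Matrix (Fin n) (Fin n) R := Matrix.of fun i l =>
  A.d i (A.d l φ) - ∑ m, A.chr i m l * A.d m φ

theorem hess_swap (i l : Fin n) : A.hess φ i l = A.hess φ l i := by
  simp only [hess, Matrix.of_apply, A.comm i l, A.chr_swap i l]

/-- `∇_i φ^p = Φ_i{}^p`. -/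
theorem nabla_grad (i : Fin n) :
    (fun p => A.d i (A.grad φ p)) + A.chr i *ᵥ A.grad φ = A.h *ᵥ A.hess φ i := by
  have h1 : (fun p => A.d i (A.grad φ p))
      = mapD (A.d i) A.h *ᵥ (fun l => A.d l φ) + A.h *ᵥ (fun l => A.d i (A.d l φ)) := by
    ext p
    simp only [grad, mulVec, dotProduct, map_sum, Derivation.leibniz, smul_eq_mul, Pi.add_apply,
      ← Finset.sum_add_distrib, mapD_apply]
    exact Finset.sum_congr rfl fun _ _ => by ring
  have h2 : A.hess φ i = (fun l => A.d i (A.d l φ)) - (A.chr i)ᵀ *ᵥ (fun l => A.d l φ) := by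
    ext l; simp [hess, mulVec, dotProduct]
  have h3 : mapD (A.d i) A.h = -(A.chr i * A.h + A.h * (A.chr i)ᵀ) := by
    rw [A.d_h, A.d_g, Matrix.mul_add, Matrix.add_mul]
    rw [← Matrix.mul_assoc A.h A.g, A.inv_mul, Matrix.one_mul]
    rw [Matrix.mul_assoc A.h, Matrix.mul_assoc _ A.g, A.mul_inv, Matrix.mul_one]
  rw [h1, h2, h3, grad, Matrix.mulVec_sub, Matrix.neg_mulVec, Matrix.add_mulVec,
    Matrix.mulVec_mulVec, Matrix.mulVec_mulVec]
  abel

/-- The components `∇_i Λ_j{}^p{}_l`, with the derivative acting on the indices `p` and `l` only. -/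
theorem IsKilling.nabla_lieChr (hk : A.IsKilling k φ) (i j p l : Fin n) :
    (mapD (A.d i) (A.lieChr k j) + (A.chr i * A.lieChr k j - A.lieChr k j * A.chr i)) p l
      = A.d i (A.d j φ) * (1 : Matrix (Fin n) (Fin n) R) p l + A.chr i p j * A.d l φ
        + (1 : Matrix (Fin n) (Fin n) R) p j * A.hess φ i l - (A.h *ᵥ A.hess φ i) p * A.g j l
        - A.grad φ p * (A.g * A.chr i) l j := by
  have h1 : A.d i (A.g j l) = (A.g * A.chr i) l j + (A.g j ᵥ* A.chr i) l := by
    have := congrFun (congrFun (A.d_g i) l) j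
    rw [Matrix.add_apply, mapD_apply, A.g_swap] at this
    rw [this]
    congr 1
    rw [← Matrix.transpose_apply ((A.chr i)ᵀ * A.g), Matrix.transpose_mul, A.symm]
    rfl
  have h2 : A.hess φ i l = A.d i (A.d l φ) - ((fun l => A.d l φ) ᵥ* A.chr i) l := by
    simp [hess, vecMul, dotProduct, mul_comm]
  have h3 : (A.chr i *ᵥ Pi.single j 1) p = A.chr i p j := by simp
  have h4 : (Pi.single j 1 : Fin n → R) p = (1 : Matrix (Fin n) (Fin n) R) p j := by
    simp [Matrix.one_apply, Pi.single_apply]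
  have h5 : A.d i ((1 : Matrix (Fin n) (Fin n) R) p j) = 0 := by
    by_cases h : p = j <;> simp [Matrix.one_apply, h]
  have h6 : A.d i ((1 : Matrix (Fin n) (Fin n) R) p l) = 0 := by
    by_cases h : p = l <;> simp [Matrix.one_apply, h]
  rw [← nabla_grad, Pi.add_apply, h2]
  rw [hk.lieChr_eq j]
  simp only [Matrix.mul_sub, Matrix.mul_add, Matrix.sub_mul, Matrix.add_mul, Matrix.smul_mul,
    Matrix.mul_smul, Matrix.mul_one, Matrix.one_mul, mul_vecMulVec, vecMulVec_mul]
  simp only [Matrix.add_apply, Matrix.sub_apply, mapD_apply, Matrix.smul_apply, vecMulVec_apply,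
    h3, h4, map_add, map_sub, Derivation.leibniz, smul_eq_mul, h1, h5, h6]
  ring

/-- The non-tensorial Christoffel terms of `IsKilling.nabla_lieChr`, and the term `∂_i ∂_j φ`, are
symmetric in `i` and `j`. They disappear on antisymmetrizing. -/
theorem IsKilling.lie_rm_apply (hk : A.IsKilling k φ) (i j p l : Fin n) :
    (mapD (A.along k) (A.rm i j) + ∑ b, A.d i (k b) • A.rm b j + ∑ b, A.d j (k b) • A.rm i b
        + (A.rm i j * A.jac k - A.jac k * A.rm i j)) p l
      = (1 : Matrix (Fin n) (Fin n) R) p j * A.hess φ i l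
        - (1 : Matrix (Fin n) (Fin n) R) p i * A.hess φ j l
        - (A.h *ᵥ A.hess φ i) p * A.g j l + (A.h *ᵥ A.hess φ j) p * A.g i l := by
  have h1 : (A.g * A.chr i) l j = (A.g * A.chr j) l i := by
    simp only [Matrix.mul_apply, A.chr_swap i j]
  rw [A.lie_rm, Matrix.sub_apply, hk.nabla_lieChr, hk.nabla_lieChr, A.comm i j, A.chr_swap i j,
    h1]
  ring

variable (A φ) in
/-- The Laplacian of a function. -/
def lap : R := (A.h * A.hess φ).trace

/-- Contract the Lie derivative of the curvature over `p = i`. The Hessian appears with coefficient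
`1 - n + 1`, and the Jacobian terms on the contracted pair cancel. -/
theorem IsKilling.along_ric (hk : A.IsKilling k φ) :
    mapD (A.along k) A.ric = -((n : R) - 2) • A.hess φ - A.lap φ • A.g
      - (A.jac k)ᵀ * A.ric - A.ric * A.jac k := by
  ext j l
  have h1 := Finset.sum_congr (rfl : (Finset.univ : Finset (Fin n)) = Finset.univ)
    fun i _ => hk.lie_rm_apply i j i l
  simp only [Matrix.add_apply, Matrix.sub_apply, Matrix.sum_apply, Matrix.smul_apply, mapD_apply,
    smul_eq_mul, Finset.sum_add_distrib, Finset.sum_sub_distrib, Matrix.mul_apply, jac,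
    Matrix.of_apply] at h1
  have h2 : ∑ i, ∑ b, A.d i (k b) * A.rm b j i l = ∑ i, ∑ b, A.d b (k i) * A.rm i j b l :=
    Finset.sum_comm
  have h3 : ∑ i, ∑ b, A.d j (k b) * A.rm i b i l = ((A.jac k)ᵀ * A.ric) j l := by
    rw [Finset.sum_comm]
    simp only [Matrix.mul_apply, Matrix.transpose_apply, jac, Matrix.of_apply, ric,
      Finset.mul_sum]
  have h4 : ∑ i, ∑ b, A.rm i j i b * A.d l (k b) = (A.ric * A.jac k) j l := by
    rw [Finset.sum_comm]
    simp only [Matrix.mul_apply, jac, Matrix.of_apply, ric, Finset.sum_mul]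
  have h5 : ∑ i, (1 : Matrix (Fin n) (Fin n) R) i j * A.hess φ i l = A.hess φ j l := by
    simp [Matrix.one_apply]
  have h6 : ∑ i, (1 : Matrix (Fin n) (Fin n) R) i i * A.hess φ j l = n * A.hess φ j l := by
    simp
  have h7 : ∑ i, (A.h *ᵥ A.hess φ i) i * A.g j l = A.lap φ * A.g j l := by
    rw [← Finset.sum_mul, lap, Matrix.trace]
    simp only [mulVec, dotProduct, Matrix.diag, Matrix.mul_apply, hess_swap]
  have h8 : ∑ i, (A.h *ᵥ A.hess φ j) i * A.g i l = A.hess φ j l := by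
    have : (A.g *ᵥ (A.h *ᵥ A.hess φ j)) l = A.hess φ j l := by
      rw [Matrix.mulVec_mulVec, A.mul_inv, Matrix.one_mulVec]
    rw [← this]
    rw [mulVec, dotProduct]
    exact Finset.sum_congr rfl fun i _ => by rw [A.g_swap i l, mul_comm]
  rw [h2, h3, h4, h5, h6, h7, h8] at h1
  simp only [Matrix.sub_apply, Matrix.smul_apply, smul_eq_mul, mapD_apply, ric_apply, map_sum]
  linear_combination h1

/-- By metricity, the Christoffel part of `nab` in the Killing equation is the directional
derivative of `g`. -/
theorem IsKilling.along_g (hk : A.IsKilling k φ) :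
    mapD (A.along k) A.g = (2 * φ) • A.g - A.g * A.jac k - (A.jac k)ᵀ * A.g := by
  have h1 : mapD (A.along k) A.g
      = A.g * (∑ b, k b • A.chr b) + (∑ b, k b • A.chr b)ᵀ * A.g := by
    simp only [A.mapD_along, A.d_g, Matrix.transpose_sum, Matrix.transpose_smul, Finset.mul_sum,
      Finset.sum_mul, Matrix.mul_smul, Matrix.smul_mul, ← Finset.sum_add_distrib, ← smul_add]
  have h2 := hk
  rw [IsKilling, nab, Matrix.mul_add, Matrix.transpose_add, Matrix.add_mul] at h2
  rw [h1, ← h2]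
  abel

theorem IsKilling.along_h (hk : A.IsKilling k φ) :
    mapD (A.along k) A.h = -(2 * φ) • A.h + A.jac k * A.h + A.h * (A.jac k)ᵀ := by
  rw [A.d_h, hk.along_g]
  simp only [Matrix.mul_sub, Matrix.sub_mul, Matrix.mul_smul, Matrix.smul_mul]
  rw [← Matrix.mul_assoc A.h A.g (A.jac k), A.inv_mul, Matrix.one_mul, Matrix.one_mul,
    Matrix.mul_assoc A.h _ A.h, Matrix.mul_assoc (A.jac k)ᵀ, A.mul_inv, Matrix.mul_one, neg_smul]
  abel

/-- The Jacobian terms of `h` and of the Ricci tensor cancel by cyclicity of the trace. -/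
theorem IsKilling.along_scal (hk : A.IsKilling k φ) :
    A.along k A.scal = -(2 * φ) * A.scal - (2 * ((n : R) - 1)) * A.lap φ := by
  have h1 : (A.h * A.g).trace = n := by rw [A.inv_mul]; simp
  have h2 : (A.jac k * A.h * A.ric).trace = (A.h * (A.ric * A.jac k)).trace := by
    rw [Matrix.mul_assoc, Matrix.trace_mul_comm, Matrix.mul_assoc]
  have h3 : (A.h * (A.jac k)ᵀ * A.ric).trace = (A.h * ((A.jac k)ᵀ * A.ric)).trace := by
    rw [Matrix.mul_assoc]
  rw [scal, mapD_trace, mapD_mul, hk.along_h, hk.along_ric]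
  simp only [Matrix.mul_sub, Matrix.add_mul, Matrix.trace_sub, Matrix.trace_add, Matrix.mul_smul,
    Matrix.smul_mul, Matrix.trace_smul, smul_eq_mul, h1, h2, h3, lap]
  ring

theorem IsKilling.along_jt (hk : A.IsKilling k φ) (hn : 3 ≤ n) :
    A.along k A.jt = -(2 * φ) * A.jt - A.lap φ := by
  have h0 : 2 * ((n : ℝ) - 1) ≠ 0 := by
    have : (3 : ℝ) ≤ n := by exact_mod_cast hn
    linarith
  have h1 : (2 * ((n : R) - 1)) * A.lap φ = (2 * ((n : ℝ) - 1)) • A.lap φ := by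
    rw [Algebra.smul_def]; simp [map_ofNat]
  rw [jt, Derivation.map_smul, hk.along_scal, h1, smul_sub, smul_smul, inv_mul_cancel₀ h0,
    one_smul, mul_smul_comm]

/-- The Lie derivative of the Schouten tensor is `-∇_a ∇_b φ`. -/
theorem IsKilling.along_sch (hk : A.IsKilling k φ) (hn : 3 ≤ n) :
    mapD (A.along k) A.sch = -A.hess φ - (A.jac k)ᵀ * A.sch - A.sch * A.jac k := by
  have h0 : (n : ℝ) - 2 ≠ 0 := by
    have : (3 : ℝ) ≤ n := by exact_mod_cast hn
    linarith
  have hs (M : Matrix (Fin n) (Fin n) R) : ((n : R) - 2) • M = ((n : ℝ) - 2) • M := by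
    rw [← algebraMap_smul R ((n : ℝ) - 2), map_sub, map_natCast, map_ofNat]
  have h1 : mapD (A.along k) A.sch
      = ((n : ℝ) - 2)⁻¹ • mapD (A.along k) (A.ric - A.jt • A.g) := by
    ext a b; simp [sch, mapD_apply]
  rw [h1, mapD_sub, mapD_smul, hk.along_ric, hk.along_g, hk.along_jt hn, A.ric_eq hn]
  rw [inv_smul_eq_iff₀ h0, ← hs]
  simp only [Matrix.mul_add, Matrix.add_mul, Matrix.mul_smul, Matrix.smul_mul]
  module

end FormalMetric

/-! ### Product rules for dot products and matrix-vector products. -/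

section VectorDerivation

open Matrix

variable {R : Type*} [CommRing R] [Algebra ℝ R] {ι κ : Type*} [Fintype κ]

theorem derivation_dotProduct (D : Derivation ℝ R R) (v w : κ → R) :
    D (v ⬝ᵥ w) = (fun i => D (v i)) ⬝ᵥ w + v ⬝ᵥ fun i => D (w i) := by
  simp only [dotProduct, map_sum, Derivation.leibniz, smul_eq_mul, ← Finset.sum_add_distrib]
  exact Finset.sum_congr rfl fun _ _ => by ring

theorem derivation_mulVec (D : Derivation ℝ R R) (M : Matrix ι κ R) (v : κ → R) :
    (fun i => D ((M *ᵥ v) i)) = mapD D M *ᵥ v + M *ᵥ fun i => D (v i) := by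
  ext i; exact derivation_dotProduct D (M i) v

end VectorDerivation

namespace FormalMetric

open Matrix

variable {n : ℕ} {R : Type*} [CommRing R] [Algebra ℝ R] (A : FormalMetric n R) (k : Fin n → R)

/-! ### The splitting operator -/

/-- The scalar slot `φ` of the splitting operator. -/
def divScal : R := (n : ℝ)⁻¹ • ∑ c, A.nab k c c

/-- The skew slot `m_{ab}` of the splitting operator. -/
def skewSlot : Matrix (Fin n) (Fin n) R :=
  (1 / 2 : ℝ) • (A.g * A.nab k - (A.g * A.nab k)ᵀ)

/-- The covariant derivative of a covariant 2-tensor. -/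
def nablaTwo (a : Fin n) (m : Matrix (Fin n) (Fin n) R) : Matrix (Fin n) (Fin n) R :=
  mapD (A.d a) m - (A.chr a)ᵀ * m - m * A.chr a

/-- The last slot `r_b` of the splitting operator. -/
def formSlot (b : Fin n) : R :=
  (n : ℝ)⁻¹ • (A.d b (A.divScal k) - ∑ a, ∑ c, A.h a c * A.nablaTwo c (A.skewSlot k) b a
    + 2 * ∑ c, A.sch b c * k c - A.jt * ∑ c, A.g b c * k c)

variable {A k} {φ : R}

/-- The Killing equation identifies the symmetric part of the lowered `∇k` with `φ g`, so
subtracting it leaves the skew part. -/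
theorem IsKilling.skewSlot_eq (hk : A.IsKilling k φ) :
    A.skewSlot k = A.g * A.nab k - φ • A.g := by
  have h1 : (A.g * A.nab k)ᵀ = (2 * φ) • A.g - A.g * A.nab k := by
    rw [Matrix.transpose_mul, A.symm, ← hk]; abel
  rw [skewSlot, h1]
  ext a b
  simp only [Matrix.smul_apply, Matrix.sub_apply, smul_eq_mul]
  apply eq_of_two_mul_eq
  rw [half_add_half_mul]; ring

theorem IsKilling.nablaTwo_skewSlot (hk : A.IsKilling k φ) (c : Fin n) :
    A.nablaTwo c (A.skewSlot k)
      = A.g * A.lieChr k c + A.g * (∑ d, k d • A.rm c d) - A.d c φ • A.g := by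
  rw [← Matrix.mul_add, ← A.nabla_nab, hk.skewSlot_eq, nablaTwo, mapD_sub, mapD_mul, mapD_smul,
    A.d_g]
  simp only [Matrix.mul_add, Matrix.add_mul, Matrix.mul_sub, Matrix.sub_mul, Matrix.mul_smul,
    Matrix.smul_mul, smul_add, Matrix.mul_assoc]
  abel

theorem g_mul_rm_apply (i j a b : Fin n) : (A.g * A.rm i j) b a = -(A.g * A.rm i j) a b := by
  have := congrFun (congrFun (A.rm_skew i j) b) a
  rw [Matrix.add_apply, Matrix.zero_apply, ← Matrix.transpose_apply ((A.rm i j)ᵀ * A.g),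
    Matrix.transpose_mul, A.symm, Matrix.transpose_transpose] at this
  exact eq_neg_of_add_eq_zero_left this

/-- In `∇m` the variation of the connection contracts to `(1 - n) dφ`, and the curvature term
contracts to a Ricci term. -/
theorem IsKilling.div_skewSlot (hk : A.IsKilling k φ) (b : Fin n) :
    ∑ a, ∑ c, A.h a c * A.nablaTwo c (A.skewSlot k) b a
      = (1 - (n : R)) * A.d b φ - ∑ d, k d * A.ric d b := by
  have hgh (f : Fin n → R) : ∑ a, ∑ c, A.h a c * (f c * A.g b a) = f b := by
    have : (A.g *ᵥ (A.h *ᵥ f)) b = f b := by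
      rw [Matrix.mulVec_mulVec, A.mul_inv, Matrix.one_mulVec]
    rw [← this]
    simp only [mulVec, dotProduct, Finset.mul_sum]
    exact Finset.sum_congr rfl fun _ _ => Finset.sum_congr rfl fun _ _ => by ring
  have h1 := hgh fun c => A.d c φ
  have h2 : ∑ a, ∑ c, A.h a c * (A.d a φ * A.g b c) = A.d b φ := by
    rw [Finset.sum_comm, ← h1]
    exact Finset.sum_congr rfl fun _ _ => Finset.sum_congr rfl fun _ _ => by rw [A.h_swap]
  have h3 : ∑ a, ∑ c, A.h a c * (A.d b φ * A.g c a) = n * A.d b φ := by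
    have : (A.h * A.g).trace = (n : R) := by rw [A.inv_mul]; simp
    rw [← this, Matrix.trace, Finset.sum_mul]
    simp only [Matrix.diag, Matrix.mul_apply, Finset.sum_mul]
    exact Finset.sum_congr rfl fun _ _ => Finset.sum_congr rfl fun _ _ => by ring
  have h4 : ∑ a, ∑ c, A.h a c * (A.g * (∑ d, k d • A.rm c d)) b a = -∑ d, k d * A.ric d b := by
    have h5 (c d : Fin n) : ∑ a, A.h a c * (A.g * A.rm c d) b a = -A.rm c d c b := by
      have : (A.h * (A.g * A.rm c d)) c b = A.rm c d c b := by
        rw [← Matrix.mul_assoc, A.inv_mul, Matrix.one_mul]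
      rw [← this, Matrix.mul_apply, ← Finset.sum_neg_distrib]
      exact Finset.sum_congr rfl fun a _ => by rw [A.h_swap a c, g_mul_rm_apply c d b a]; ring
    simp only [Finset.mul_sum, Matrix.mul_smul, Matrix.sum_apply, Matrix.smul_apply, smul_eq_mul,
      ric, Matrix.of_apply]
    rw [Finset.sum_comm]
    calc ∑ c, ∑ a, ∑ d, A.h a c * (k d * (A.g * A.rm c d) b a)
        = ∑ c, ∑ d, k d * ∑ a, A.h a c * (A.g * A.rm c d) b a := by
          refine Finset.sum_congr rfl fun c _ => ?_
          rw [Finset.sum_comm]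
          refine Finset.sum_congr rfl fun d _ => ?_
          rw [Finset.mul_sum]
          exact Finset.sum_congr rfl fun a _ => by ring
      _ = -∑ d, ∑ c, k d * A.rm c d c b := by
          simp only [h5, mul_neg, Finset.sum_neg_distrib]
          rw [Finset.sum_comm]
  have h6 (a c : Fin n) : A.h a c * A.nablaTwo c (A.skewSlot k) b a
      = A.h a c * (A.d a φ * A.g b c) - A.h a c * (A.d b φ * A.g c a)
        + A.h a c * (A.g * (∑ d, k d • A.rm c d)) b a := by
    rw [hk.nablaTwo_skewSlot, Matrix.sub_apply, Matrix.add_apply, hk.g_lieChr_apply,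
      Matrix.smul_apply, smul_eq_mul]
    ring
  simp only [h6, Finset.sum_add_distrib, Finset.sum_sub_distrib, h2, h3, h4]
  ring

/-- Decompose Ricci as `(n - 2) P + J g`. The correction `2 P k - J k` in the splitting operator
completes this to `n P k`, and the multiples of `dφ` add up to `n dφ`. -/
theorem IsKilling.formSlot_eq (hk : A.IsKilling k (A.divScal k)) (hn : 3 ≤ n) (b : Fin n) :
    A.formSlot k b = A.d b (A.divScal k) + (A.sch *ᵥ k) b := by
  have h0 : (n : ℝ) ≠ 0 := by
    have : (3 : ℝ) ≤ n := by exact_mod_cast hn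
    linarith
  have hs (f : R) : (n : ℝ) • f = n * f := by rw [Algebra.smul_def]; simp
  have h1 : ∑ d, k d * A.ric d b
      = ((n : R) - 2) * (A.sch *ᵥ k) b + A.jt * ∑ c, A.g b c * k c := by
    rw [A.ric_eq hn]
    simp only [mulVec, dotProduct, Finset.mul_sum, ← Finset.sum_add_distrib, Matrix.add_apply,
      Matrix.smul_apply, smul_eq_mul]
    exact Finset.sum_congr rfl fun c _ => by rw [A.g_swap b c, A.sch_swap b c]; ring
  rw [formSlot, hk.div_skewSlot, h1, inv_smul_eq_iff₀ h0, hs]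
  simp only [mulVec, dotProduct]
  ring

/-! ### Tractors -/

variable (A)

/-- The tractor connection. -/
def nablaT (a : Fin n) (V : R × (Fin n → R) × R) : R × (Fin n → R) × R :=
  (A.d a V.1 - A.g a ⬝ᵥ V.2.1,
    (fun b => A.d a (V.2.1 b)) + A.chr a *ᵥ V.2.1 + V.2.2 • Pi.single a 1
      + V.1 • (A.h *ᵥ A.sch a),
    A.d a V.2.2 - A.sch a ⬝ᵥ V.2.1)

/-- The tractor metric. -/
def metricT (V W : R × (Fin n → R) × R) : R :=
  V.2.1 ⬝ᵥ A.g *ᵥ W.2.1 + V.1 * W.2.2 + V.2.2 * W.1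

theorem nablaT_add (a : Fin n) (V W : R × (Fin n → R) × R) :
    A.nablaT a (V + W) = A.nablaT a V + A.nablaT a W := by
  refine Prod.ext ?_ (Prod.ext ?_ ?_)
  · simp [nablaT]; ring
  · simp only [nablaT, Prod.fst_add, Prod.snd_add, Matrix.mulVec_add, Pi.add_apply, map_add]
    ext b; simp; ring
  · simp [nablaT]; ring

theorem nablaT_smul (a : Fin n) (f : R) (V : R × (Fin n → R) × R) :
    A.nablaT a (f • V) = A.d a f • V + f • A.nablaT a V := by
  refine Prod.ext ?_ (Prod.ext ?_ ?_)
  · simp [nablaT]; ring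
  · simp only [nablaT, Prod.smul_fst, Prod.smul_snd, Matrix.mulVec_smul, Prod.fst_add,
      Prod.snd_add]
    ext b; simp; ring
  · simp [nablaT]; ring

theorem nablaT_sum {α : Type*} (a : Fin n) (s : Finset α) (V : α → R × (Fin n → R) × R) :
    A.nablaT a (∑ i ∈ s, V i) = ∑ i ∈ s, A.nablaT a (V i) :=
  map_sum (AddMonoidHom.mk' (A.nablaT a) (A.nablaT_add a)) V s

theorem nablaT_sub (a : Fin n) (V W : R × (Fin n → R) × R) :
    A.nablaT a (V - W) = A.nablaT a V - A.nablaT a W :=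
  map_sub (AddMonoidHom.mk' (A.nablaT a) (A.nablaT_add a)) V W

theorem g_row (a : Fin n) : A.g *ᵥ Pi.single a 1 = A.g a := by
  ext b; simp [A.g_swap a b]

theorem dotProduct_g_comm (v w : Fin n → R) : v ⬝ᵥ A.g *ᵥ w = w ⬝ᵥ A.g *ᵥ v := by
  rw [dotProduct_mulVec, ← mulVec_transpose, A.symm, dotProduct_comm]

/-- The tractor connection is metric. -/
theorem d_metricT (a : Fin n) (V W : R × (Fin n → R) × R) :
    A.d a (A.metricT V W) = A.metricT (A.nablaT a V) W + A.metricT V (A.nablaT a W) := by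
  have h1 : A.g *ᵥ (A.h *ᵥ A.sch a) = A.sch a := by
    rw [Matrix.mulVec_mulVec, A.mul_inv, Matrix.one_mulVec]
  have h2 (v w : Fin n → R) : v ⬝ᵥ ((A.chr a)ᵀ * A.g) *ᵥ w = (A.chr a *ᵥ v) ⬝ᵥ A.g *ᵥ w := by
    rw [← Matrix.mulVec_mulVec, dotProduct_mulVec, vecMul_transpose]
  rw [metricT, map_add, map_add, derivation_dotProduct, derivation_mulVec, A.d_g, Matrix.add_mulVec,
    dotProduct_add, dotProduct_add, h2, ← Matrix.mulVec_mulVec]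
  simp only [metricT, nablaT, Derivation.leibniz, smul_eq_mul, Matrix.mulVec_add, dotProduct_add,
    add_dotProduct, Matrix.mulVec_smul, smul_dotProduct, dotProduct_smul, A.g_row, h1]
  rw [A.dotProduct_g_comm (Pi.single a 1), A.g_row, A.dotProduct_g_comm (A.h *ᵥ A.sch a), h1,
    dotProduct_comm V.2.1 (A.g a), dotProduct_comm V.2.1 (A.sch a),
    dotProduct_comm W.2.1 (A.g a), dotProduct_comm W.2.1 (A.sch a)]
  ring

variable (k φ)

/-- The skew endomorphism `S` of the tractor bundle determined by a conformal Killing field. -/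
def endoT (V : R × (Fin n → R) × R) : R × (Fin n → R) × R :=
  (φ * V.1 - (A.g *ᵥ k) ⬝ᵥ V.2.1,
    V.1 • (A.grad φ + A.h *ᵥ (A.sch *ᵥ k)) + (A.nab k *ᵥ V.2.1 - φ • V.2.1) + V.2.2 • k,
    -(φ * V.2.2) - ((fun l => A.d l φ) + A.sch *ᵥ k) ⬝ᵥ V.2.1)

/-- The Lie derivative of tractors along a conformal Killing field. -/
def lieT (V : R × (Fin n → R) × R) : R × (Fin n → R) × R :=
  (A.along k V.1 - φ * V.1,
    (fun b => A.along k (V.2.1 b)) - A.jac k *ᵥ V.2.1 + φ • V.2.1 - V.1 • A.grad φ,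
    A.along k V.2.2 + φ * V.2.2 + (fun l => A.d l φ) ⬝ᵥ V.2.1)

/-- All derivatives of `V` cancel in `∇_k - L_k`, which is therefore algebraic. This needs only the
symmetry of `g` and `P`, not the Killing equation. -/
theorem endoT_eq (V : R × (Fin n → R) × R) :
    A.endoT k φ V = ∑ b, k b • A.nablaT b V - A.lieT k φ V := by
  have hrow (M : Matrix (Fin n) (Fin n) R) (hM : Mᵀ = M) (v : Fin n → R) :
      ∑ b, k b * (M b ⬝ᵥ v) = (M *ᵥ k) ⬝ᵥ v := by
    rw [show M *ᵥ k = k ᵥ* M by rw [← vecMul_transpose, hM], ← dotProduct_mulVec]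
    rfl
  refine Prod.ext ?_ (Prod.ext ?_ ?_)
  · rw [Prod.fst_sub, Prod.fst_sum]
    simp only [Prod.smul_fst, nablaT, lieT, endoT, smul_eq_mul, mul_sub, Finset.sum_sub_distrib,
      hrow _ A.symm, along_apply]
    ring
  · rw [Prod.snd_sub, Prod.fst_sub, Prod.snd_sum, Prod.fst_sum]
    have h1 : ∑ b, k b • (fun c => A.d b (V.2.1 c)) = fun c => A.along k (V.2.1 c) := by
      ext c; simp [along_apply, Finset.sum_apply]
    have h2 : ∑ b, k b • (A.chr b *ᵥ V.2.1) = (∑ b, k b • A.chr b) *ᵥ V.2.1 := by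
      rw [Matrix.sum_mulVec]; simp only [Matrix.smul_mulVec]
    have h3 : ∑ b, k b • (V.2.2 • (Pi.single b 1 : Fin n → R)) = V.2.2 • k := by
      ext c; simp [Finset.sum_apply, Pi.single_apply, mul_comm]
    have h4 : ∑ b, k b • (V.1 • (A.h *ᵥ A.sch b)) = V.1 • (A.h *ᵥ (A.sch *ᵥ k)) := by
      have : A.sch *ᵥ k = ∑ b, k b • A.sch b := by
        rw [show A.sch *ᵥ k = k ᵥ* A.sch by rw [← vecMul_transpose, A.sch_symm]]
        ext c; simp [vecMul, dotProduct, Finset.sum_apply]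
      rw [this, Matrix.mulVec_sum, Finset.smul_sum]
      exact Finset.sum_congr rfl fun b _ => by rw [Matrix.mulVec_smul, smul_comm]
    simp only [Prod.smul_snd, Prod.smul_fst, nablaT, lieT, endoT, smul_add,
      Finset.sum_add_distrib, h1, h2, h3, h4, nab, Matrix.add_mulVec]
    module
  · rw [Prod.snd_sub, Prod.snd_sub, Prod.snd_sum, Prod.snd_sum]
    simp only [Prod.smul_snd, nablaT, lieT, endoT, smul_eq_mul, mul_sub, Finset.sum_sub_distrib,
      hrow _ A.sch_symm, along_apply, add_dotProduct]
    ring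

variable {A k φ}

/-- The Lie derivative along a conformal Killing field commutes with the tractor connection. -/
theorem IsKilling.lieT_nablaT (hk : A.IsKilling k φ) (hn : 3 ≤ n) (a : Fin n)
    (V : R × (Fin n → R) × R) :
    A.lieT k φ (A.nablaT a V) + ∑ b, A.d a (k b) • A.nablaT b V
      = A.nablaT a (A.lieT k φ V) := by
  have hrow (M : Matrix (Fin n) (Fin n) R) (v : Fin n → R) :
      ∑ b, A.d a (k b) * (M b ⬝ᵥ v) = ((A.jac k)ᵀ * M) a ⬝ᵥ v := by
    rw [show ((A.jac k)ᵀ * M) a = (A.jac k)ᵀ a ᵥ* M from rfl, ← dotProduct_mulVec]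
    rfl
  have hrow' (M N : Matrix (Fin n) (Fin n) R) (v : Fin n → R) :
      (M * N) a ⬝ᵥ v = M a ⬝ᵥ N *ᵥ v := by
    rw [show (M * N) a = M a ᵥ* N from rfl, ← dotProduct_mulVec]
  have hgrad : A.g a ⬝ᵥ A.grad φ = A.d a φ := by
    change (A.g *ᵥ A.grad φ) a = _
    rw [grad, Matrix.mulVec_mulVec, A.mul_inv, Matrix.one_mulVec]
  refine Prod.ext ?_ (Prod.ext ?_ ?_)
  -- The top slot only involves the Lie derivative of the metric.
  · have hg : (fun i => A.along k (A.g a i)) = (2 * φ) • A.g a - (A.g * A.jac k) a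
        - ((A.jac k)ᵀ * A.g) a := congrFun hk.along_g a
    rw [Prod.fst_add, Prod.fst_sum]
    simp only [Prod.smul_fst, nablaT, lieT, smul_eq_mul, mul_sub, Finset.sum_sub_distrib,
      hrow, map_sub, map_add, derivation_dotProduct, A.along_comm, hg, sub_dotProduct,
      smul_dotProduct, hrow', dotProduct_add, dotProduct_sub, dotProduct_smul, hgrad,
      Derivation.leibniz]
    ring
  -- In the middle slot the coefficient of `V.2.1` is the variation of the connection. The
  -- coefficient of `V.1` combines the Lie derivative of `P` with `∇ grad φ`, so that the Hessians
  -- cancel.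
  · have hΛ := congrArg (fun M => M *ᵥ V.2.1) (hk.lieChr_eq a)
    simp only [lieChr, Matrix.sub_mulVec, Matrix.add_mulVec, Matrix.smul_mulVec,
      Matrix.one_mulVec, vecMulVec_mulVec, ← Matrix.mulVec_mulVec, Matrix.sum_mulVec,
      op_smul_eq_smul] at hΛ
    have hP : (fun i => A.along k (A.sch a i)) = -A.hess φ a - ((A.jac k)ᵀ * A.sch) a
        - (A.sch * A.jac k) a := congrFun (hk.along_sch hn) a
    have hE : A.jac k *ᵥ Pi.single a 1
        = ∑ b, A.d a (k b) • (Pi.single b 1 : Fin n → R) := by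
      ext c; simp [jac, Finset.sum_apply, Pi.single_apply]
    have hPE : (A.sch * A.jac k) a = (A.jac k)ᵀ *ᵥ A.sch a := by
      rw [show (A.sch * A.jac k) a = A.sch a ᵥ* A.jac k from rfl, mulVec_transpose]
    have hEP : ((A.jac k)ᵀ * A.sch) a = ∑ b, A.d a (k b) • A.sch b := by
      ext c; simp [Matrix.mul_apply, jac, Finset.sum_apply]
    have hD : (fun i => A.along k ((A.h *ᵥ A.sch a) i))
        = -(2 * φ) • (A.h *ᵥ A.sch a) + A.jac k *ᵥ (A.h *ᵥ A.sch a)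
          - A.h *ᵥ A.hess φ a - ∑ b, A.d a (k b) • (A.h *ᵥ A.sch b) := by
      rw [derivation_mulVec, hk.along_h, hP, hPE, hEP]
      simp only [Matrix.add_mulVec, Matrix.mulVec_sub, Matrix.mulVec_neg, Matrix.smul_mulVec,
        ← Matrix.mulVec_mulVec, Matrix.mulVec_sum, Matrix.mulVec_smul]
      module
    have hN := A.nabla_grad (φ := φ) a
    have e1 : (fun b => A.along k (A.d a (V.2.1 b)))
        = (fun b => A.d a (A.along k (V.2.1 b))) - ∑ b, A.d a (k b) • fun c => A.d b (V.2.1 c) := by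
      ext c; simp [along_comm, Finset.sum_apply]
    have e2 : (fun b => A.along k ((A.nablaT a V).2.1 b))
        = (fun b => A.along k (A.d a (V.2.1 b)))
          + (mapD (A.along k) (A.chr a) *ᵥ V.2.1 + A.chr a *ᵥ fun b => A.along k (V.2.1 b))
          + A.along k V.2.2 • Pi.single a 1
          + (A.along k V.1 • (A.h *ᵥ A.sch a)
            + V.1 • fun i => A.along k ((A.h *ᵥ A.sch a) i)) := by
      rw [← derivation_mulVec]
      ext c
      by_cases hc : c = a
      · subst hc; simp [nablaT]; ring
      · simp [nablaT, hc]; ring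
    have e3 : (fun b => A.d a ((A.lieT k φ V).2.1 b))
        = (fun b => A.d a (A.along k (V.2.1 b)))
          - (mapD (A.d a) (A.jac k) *ᵥ V.2.1 + A.jac k *ᵥ fun b => A.d a (V.2.1 b))
          + (A.d a φ • V.2.1 + φ • fun b => A.d a (V.2.1 b))
          - (A.d a V.1 • A.grad φ + V.1 • fun p => A.d a (A.grad φ p)) := by
      rw [← derivation_mulVec]
      ext c
      simp [lieT]; ring
    rw [Prod.snd_add, Prod.fst_add, Prod.snd_sum, Prod.fst_sum]
    rw [show (A.lieT k φ (A.nablaT a V)).2.1 = (fun b => A.along k ((A.nablaT a V).2.1 b))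
      - A.jac k *ᵥ (A.nablaT a V).2.1 + φ • (A.nablaT a V).2.1 - (A.nablaT a V).1 • A.grad φ
      from rfl, e2, e1, hD]
    rw [show (A.nablaT a (A.lieT k φ V)).2.1 = (fun b => A.d a ((A.lieT k φ V).2.1 b))
      + A.chr a *ᵥ (A.lieT k φ V).2.1 + (A.lieT k φ V).2.2 • Pi.single a 1
      + (A.lieT k φ V).1 • (A.h *ᵥ A.sch a) from rfl, e3]
    simp only [nablaT, lieT, Prod.smul_snd, Prod.smul_fst, smul_add, Finset.sum_add_distrib,
      Matrix.mulVec_add, Matrix.mulVec_sub, Matrix.mulVec_smul, hE]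
    rw [show ∑ b, A.d a (k b) • V.2.2 • (Pi.single b 1 : Fin n → R)
        = V.2.2 • ∑ b, A.d a (k b) • (Pi.single b 1 : Fin n → R) by
          rw [Finset.smul_sum]; exact Finset.sum_congr rfl fun b _ => smul_comm _ _ _,
      show ∑ b, A.d a (k b) • V.1 • (A.h *ᵥ A.sch b)
        = V.1 • ∑ b, A.d a (k b) • (A.h *ᵥ A.sch b) by
          rw [Finset.smul_sum]; exact Finset.sum_congr rfl fun b _ => smul_comm _ _ _]
    linear_combination (norm := module) hΛ + V.1 • hN
  -- In the bottom slot the Hessian from the Lie derivative of `P` matches the one from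
  -- differentiating `dφ`.
  · have hP : (fun i => A.along k (A.sch a i)) = -A.hess φ a - ((A.jac k)ᵀ * A.sch) a
        - (A.sch * A.jac k) a := congrFun (hk.along_sch hn) a
    have hH : A.hess φ a ⬝ᵥ V.2.1 = (fun l => A.d a (A.d l φ)) ⬝ᵥ V.2.1
        - (fun l => A.d l φ) ⬝ᵥ A.chr a *ᵥ V.2.1 := by
      rw [dotProduct_mulVec, ← sub_dotProduct]
      congr 1
      ext l; simp [hess, vecMul, dotProduct, mul_comm]
    have hS : (fun l => A.d l φ) ⬝ᵥ (A.h *ᵥ A.sch a) = A.sch a ⬝ᵥ A.grad φ := by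
      rw [grad, dotProduct_mulVec, ← mulVec_transpose, A.h_symm, dotProduct_comm]
    rw [Prod.snd_add, Prod.snd_add, Prod.snd_sum, Prod.snd_sum]
    simp only [Prod.smul_snd, nablaT, lieT, smul_eq_mul, mul_sub, Finset.sum_sub_distrib,
      hrow, map_sub, map_add, derivation_dotProduct, A.along_comm, hP, sub_dotProduct,
      neg_dotProduct, hrow', dotProduct_add, dotProduct_sub, dotProduct_smul,
      Derivation.leibniz, hH, hS, dotProduct_single, mul_one]
    ring

/-- The prolonged conformal Killing equation. -/
theorem IsKilling.nablaT_endoT (hk : A.IsKilling k φ) (hn : 3 ≤ n) (a : Fin n)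
    (V : R × (Fin n → R) × R) :
    A.nablaT a (A.endoT k φ V) - A.endoT k φ (A.nablaT a V)
      = ∑ b, k b • (A.nablaT a (A.nablaT b V) - A.nablaT b (A.nablaT a V)) := by
  rw [endoT_eq, endoT_eq, nablaT_sub, nablaT_sum, ← hk.lieT_nablaT hn]
  simp only [nablaT_smul, Finset.sum_add_distrib, smul_sub, Finset.sum_sub_distrib]
  abel

end FormalMetric

/-! ### The splitting operator as a bilinear form, and its covariant derivative. -/

namespace FormalMetric

open Matrix

variable {n : ℕ} {R : Type*} [CommRing R] [Algebra ℝ R] (A : FormalMetric n R) (k : Fin n → R)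

/-- The splitting operator applied to `k`, as a bilinear form on tractors. -/
def evalT (V W : R × (Fin n → R) × R) : R :=
  A.divScal k * (V.1 * W.2.2 - V.2.2 * W.1)
    + V.2.2 * (k ⬝ᵥ A.g *ᵥ W.2.1) - W.2.2 * (k ⬝ᵥ A.g *ᵥ V.2.1)
    + V.1 * (A.formSlot k ⬝ᵥ W.2.1) - W.1 * (A.formSlot k ⬝ᵥ V.2.1)
    + W.2.1 ⬝ᵥ A.skewSlot k *ᵥ V.2.1

variable {A k}

/-- By skewness `⟨S V, W⟩ = -⟨V, S W⟩`. With `S` on the second argument, the metric property of the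
connection and the formula for `∇S` apply directly. -/
theorem IsKilling.evalT_eq (hk : A.IsKilling k (A.divScal k)) (hn : 3 ≤ n)
    (V W : R × (Fin n → R) × R) :
    A.evalT k V W = -A.metricT V (A.endoT k (A.divScal k) W) := by
  have hf : A.formSlot k = (fun l => A.d l (A.divScal k)) + A.sch *ᵥ k :=
    funext fun b => hk.formSlot_eq hn b
  have hg : A.g *ᵥ (A.grad (A.divScal k) + A.h *ᵥ (A.sch *ᵥ k)) = A.formSlot k := by
    rw [hf, grad, ← Matrix.mulVec_add, Matrix.mulVec_mulVec, A.mul_inv, Matrix.one_mulVec]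
  have ht : (A.skewSlot k)ᵀ = -A.skewSlot k := by
    rw [skewSlot, Matrix.transpose_smul, Matrix.transpose_sub, Matrix.transpose_transpose,
      ← smul_neg, neg_sub]
  have hs : W.2.1 ⬝ᵥ A.skewSlot k *ᵥ V.2.1
      = -(V.2.1 ⬝ᵥ A.g *ᵥ (A.nab k *ᵥ W.2.1 - A.divScal k • W.2.1)) := by
    have : A.g *ᵥ (A.nab k *ᵥ W.2.1 - A.divScal k • W.2.1) = A.skewSlot k *ᵥ W.2.1 := by
      rw [hk.skewSlot_eq, Matrix.sub_mulVec, Matrix.mulVec_sub, Matrix.mulVec_mulVec,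
        Matrix.smul_mulVec, Matrix.mulVec_smul]
    rw [this, dotProduct_mulVec, ← mulVec_transpose, ht, Matrix.neg_mulVec, neg_dotProduct,
      dotProduct_comm]
  rw [evalT, hs, metricT, endoT]
  simp only [Matrix.mulVec_add, Matrix.mulVec_smul, dotProduct_add, dotProduct_smul, smul_eq_mul]
  rw [Matrix.mulVec_add] at hg
  rw [← dotProduct_add, hg, ← hf, A.dotProduct_g_comm k W.2.1, A.dotProduct_g_comm k V.2.1,
    dotProduct_comm (A.g *ᵥ k), dotProduct_comm (A.formSlot k) V.2.1]
  ring

theorem IsKilling.d_evalT (hk : A.IsKilling k (A.divScal k)) (hn : 3 ≤ n) (a : Fin n)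
    (V W : R × (Fin n → R) × R) :
    A.d a (A.evalT k V W) = A.evalT k (A.nablaT a V) W + A.evalT k V (A.nablaT a W)
      - ∑ b, k b * A.metricT V (A.nablaT a (A.nablaT b W) - A.nablaT b (A.nablaT a W)) := by
  have hadd (X Y : R × (Fin n → R) × R) : A.metricT V (X + Y) = A.metricT V X + A.metricT V Y := by
    simp [metricT, Matrix.mulVec_add]; ring
  have hsmul (f : R) (X : R × (Fin n → R) × R) : A.metricT V (f • X) = f * A.metricT V X := by
    simp [metricT, Matrix.mulVec_smul]; ring
  have hsum : A.metricT V (∑ b, k b • (A.nablaT a (A.nablaT b W) - A.nablaT b (A.nablaT a W)))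
      = ∑ b, k b * A.metricT V (A.nablaT a (A.nablaT b W) - A.nablaT b (A.nablaT a W)) := by
    simp only [← hsmul]
    exact map_sum (AddMonoidHom.mk' (A.metricT V) hadd) _ _
  have h1 : A.nablaT a (A.endoT k (A.divScal k) W) = A.endoT k (A.divScal k) (A.nablaT a W)
      + ∑ b, k b • (A.nablaT a (A.nablaT b W) - A.nablaT b (A.nablaT a W)) := by
    rw [← hk.nablaT_endoT hn]; abel
  rw [← hsum, hk.evalT_eq hn, hk.evalT_eq hn, hk.evalT_eq hn, map_neg, d_metricT, h1, hadd]
  ring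

end FormalMetric

/-! ### Smooth functions on an open set of the coordinate space -/

section Smooth

variable {n : ℕ} (Ω : TopologicalSpace.Opens (Coord n))

/-- The algebra of smooth functions on an open set of the coordinate space. -/
def smoothFun : Subalgebra ℝ (Ω → ℝ) where
  carrier := {f | ContDiffOn ℝ ∞ (Function.extend Subtype.val f 0) Ω}
  mul_mem' {f g} hf hg := (hf.mul hg).congr fun y hy => by
    simp [Subtype.val_injective.extend_apply f 0 ⟨y, hy⟩,
      Subtype.val_injective.extend_apply g 0 ⟨y, hy⟩,
      Subtype.val_injective.extend_apply (f * g) 0 ⟨y, hy⟩]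
  add_mem' {f g} hf hg := (hf.add hg).congr fun y hy => by
    simp [Subtype.val_injective.extend_apply f 0 ⟨y, hy⟩,
      Subtype.val_injective.extend_apply g 0 ⟨y, hy⟩,
      Subtype.val_injective.extend_apply (f + g) 0 ⟨y, hy⟩]
  algebraMap_mem' c := (contDiffOn_const (c := c)).congr fun y hy =>
    Subtype.val_injective.extend_apply (algebraMap ℝ (Ω → ℝ) c) 0 ⟨y, hy⟩

variable {Ω}

/-- Evaluation of smooth functions at a point. -/
def smoothEval (y : Ω) : smoothFun Ω →ₐ[ℝ] ℝ := (Pi.evalAlgHom ℝ (fun _ : Ω => ℝ) y).comp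
  (smoothFun Ω).val

theorem smoothEval_ext {f g : smoothFun Ω} (h : ∀ y, smoothEval y f = smoothEval y g) : f = g :=
  Subtype.ext (funext h)

/-- The smooth function `f` on `Ω` is the restriction of `F`. -/
def Rep (f : smoothFun Ω) (F : Coord n → ℝ) : Prop := ∀ y : Ω, smoothEval y f = F y

/-- The zero extension of a smooth function. -/
def smoothExt (f : smoothFun Ω) : Coord n → ℝ := Function.extend Subtype.val f.1 0

theorem rep_smoothExt (f : smoothFun Ω) : Rep f (smoothExt f) := fun y =>
  (Subtype.val_injective.extend_apply f.1 0 y).symm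

theorem Rep.eqOn {f : smoothFun Ω} {F G : Coord n → ℝ} (hF : Rep f F) (hG : Rep f G) :
    Set.EqOn F G Ω := fun y hy => (hF ⟨y, hy⟩).symm.trans (hG ⟨y, hy⟩)

theorem Rep.contDiffOn {f : smoothFun Ω} {F : Coord n → ℝ} (hF : Rep f F) :
    ContDiffOn ℝ ∞ F Ω := ContDiffOn.congr f.2 (hF.eqOn (rep_smoothExt f))

theorem Rep.differentiableAt {f : smoothFun Ω} {F : Coord n → ℝ} (hF : Rep f F) (y : Ω) :
    DifferentiableAt ℝ F y :=
  (hF.contDiffOn.differentiableOn (by simp)).differentiableAt (Ω.isOpen.mem_nhds y.2)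

theorem exists_rep {F : Coord n → ℝ} (hF : ContDiffOn ℝ ∞ F Ω) : ∃ f : smoothFun Ω, Rep f F :=
  ⟨⟨fun y => F y, hF.congr fun y hy =>
    Subtype.val_injective.extend_apply (fun y : Ω => F y) 0 ⟨y, hy⟩⟩, fun _ => rfl⟩

theorem Rep.add {f g : smoothFun Ω} {F G : Coord n → ℝ} (hF : Rep f F) (hG : Rep g G) :
    Rep (f + g) (F + G) := fun y => by rw [map_add, hF, hG]; rfl

theorem Rep.mul {f g : smoothFun Ω} {F G : Coord n → ℝ} (hF : Rep f F) (hG : Rep g G) :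
    Rep (f * g) (F * G) := fun y => by rw [map_mul, hF, hG]; rfl

theorem Rep.pd_eq {f : smoothFun Ω} {F G : Coord n → ℝ} (hF : Rep f F) (hG : Rep f G)
    (i : Fin n) (y : Ω) : pd i F y = pd i G y := by
  have : F =ᶠ[nhds (y : Coord n)] G := (hF.eqOn hG).eventuallyEq_of_mem (Ω.isOpen.mem_nhds y.2)
  rw [pd, pd, this.fderiv_eq]

theorem contDiffOn_pd {F : Coord n → ℝ} (hF : ContDiffOn ℝ ∞ F Ω) (i : Fin n) :
    ContDiffOn ℝ ∞ (pd i F) Ω :=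
  (hF.fderiv_of_isOpen Ω.isOpen (by simp)).clm_apply contDiffOn_const

/-- The partial derivative as a derivation of the algebra of smooth functions. -/
def smoothPd (i : Fin n) : Derivation ℝ (smoothFun Ω) (smoothFun Ω) :=
  Derivation.mk'
    { toFun := fun f => ⟨fun y => pd i (smoothExt f) y,
        (contDiffOn_pd (rep_smoothExt f).contDiffOn i).congr fun y hy =>
          Subtype.val_injective.extend_apply (fun y : Ω => pd i (smoothExt f) y) 0 ⟨y, hy⟩⟩
      map_add' := fun f g => Subtype.ext <| funext fun y => by
        change pd i (smoothExt (f + g)) y = pd i (smoothExt f) y + pd i (smoothExt g) y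
        rw [(rep_smoothExt (f + g)).pd_eq ((rep_smoothExt f).add (rep_smoothExt g)), pd, pd, pd,
          fderiv_add ((rep_smoothExt f).differentiableAt y) ((rep_smoothExt g).differentiableAt y)]
        rfl
      map_smul' := fun c f => Subtype.ext <| funext fun y => by
        change pd i (smoothExt (c • f)) y = c * pd i (smoothExt f) y
        have h : Rep (c • f) (c • smoothExt f) := fun y => by
          rw [map_smul, rep_smoothExt f]; rfl
        rw [(rep_smoothExt (c • f)).pd_eq h, pd, pd,
          fderiv_const_smul ((rep_smoothExt f).differentiableAt y)]
        rfl }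
    fun f g => Subtype.ext <| funext fun y => by
      change pd i (smoothExt (f * g)) y
        = smoothEval y f * pd i (smoothExt g) y + smoothEval y g * pd i (smoothExt f) y
      rw [(rep_smoothExt (f * g)).pd_eq ((rep_smoothExt f).mul (rep_smoothExt g)), pd, pd, pd,
        fderiv_mul ((rep_smoothExt f).differentiableAt y) ((rep_smoothExt g).differentiableAt y),
        rep_smoothExt f, rep_smoothExt g]
      rfl

theorem Rep.pd {f : smoothFun Ω} {F : Coord n → ℝ} (hF : Rep f F) (i : Fin n) :
    Rep (smoothPd i f) (pd i F) := fun y => (rep_smoothExt f).pd_eq hF i y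

theorem smoothPd_comm (i j : Fin n) (f : smoothFun Ω) :
    smoothPd i (smoothPd j f) = smoothPd j (smoothPd i f) := by
  refine smoothEval_ext fun y => ?_
  rw [((rep_smoothExt f).pd j).pd i y, ((rep_smoothExt f).pd i).pd j y]
  have h1 : ContDiffAt ℝ ∞ (smoothExt f) y :=
    (rep_smoothExt f).contDiffOn.contDiffAt (Ω.isOpen.mem_nhds y.2)
  have h2 : DifferentiableAt ℝ (fderiv ℝ (smoothExt f)) y :=
    (h1.fderiv_right (m := 1) (by norm_cast)).differentiableAt (by simp)
  have h3 : IsSymmSndFDerivAt ℝ (smoothExt f) y :=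
    h1.isSymmSndFDerivAt (by simp [minSmoothness_of_isRCLikeNormedField]; norm_cast)
  have h4 (i j : Fin n) : ConformalTractor.pd i (ConformalTractor.pd j (smoothExt f)) y
      = fderiv ℝ (fderiv ℝ (smoothExt f)) y (EuclideanSpace.single i 1)
        (EuclideanSpace.single j 1) := by
    rw [ConformalTractor.pd]
    unfold ConformalTractor.pd
    rw [fderiv_clm_apply h2 (differentiableAt_const _)]
    simp
  rw [h4, h4, h3]

/-- This makes the metric determinant a unit, so the inverse metric exists within the algebra. -/
theorem isUnit_smoothFun {f : smoothFun Ω} (hf : ∀ y, smoothEval y f ≠ 0) : IsUnit f := by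
  have h1 : ContDiffOn ℝ ∞ (fun y => (smoothExt f y)⁻¹) Ω :=
    (rep_smoothExt f).contDiffOn.inv fun y hy => by
      rw [← rep_smoothExt f ⟨y, hy⟩]; exact hf _
  obtain ⟨g, hg⟩ := exists_rep h1
  refine IsUnit.of_mul_eq_one g (smoothEval_ext fun y => ?_)
  have h2 : smoothEval y g = (smoothEval y f)⁻¹ := by rw [hg, rep_smoothExt f]
  rw [map_mul, h2, map_one, mul_inv_cancel₀ (hf y)]

/-- The metric `A` over the algebra of smooth functions on `Ω` has the components `G`. -/
structure Represents (A : FormalMetric n (smoothFun Ω)) (G : MatField n) : Prop where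
  d_eq : A.d = smoothPd
  g_rep : ∀ i j, Rep (A.g i j) fun y => G y i j
  h_rep : ∀ i j, Rep (A.h i j) fun y => (G y)⁻¹ i j

/-- A metric in local coordinates gives a metric over the algebra of smooth functions. -/
theorem exists_formalMetric {G : MatField n}
    (hG : ∀ i j, ContDiffOn ℝ ∞ (fun y => G y i j) Ω)
    (hsymm : ∀ y ∈ Ω, (G y).transpose = G y) (hdet : ∀ y ∈ Ω, (G y).det ≠ 0) :
    ∃ A : FormalMetric n (smoothFun Ω), Represents A G := by
  choose g hg using fun i j => exists_rep (hG i j)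
  have hmap (y : Ω) : (Matrix.of g).map (smoothEval y) = G y := by
    ext i j; exact hg i j y
  have hu : IsUnit (Matrix.of g).det := isUnit_smoothFun fun y => by
    have : smoothEval y (Matrix.of g).det = ((Matrix.of g).map (smoothEval y)).det :=
      (smoothEval y).toRingHom.map_det _
    rw [this, hmap]; exact hdet y y.2
  refine ⟨⟨smoothPd, smoothPd_comm, Matrix.of g, (Matrix.of g)⁻¹, ?_,
    Matrix.mul_nonsing_inv _ hu⟩, rfl, hg, fun i j y => ?_⟩
  · ext1 i j
    refine smoothEval_ext fun y => ?_
    change smoothEval y (g j i) = smoothEval y (g i j)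
    rw [hg, hg]
    exact congrFun (congrFun (hsymm y y.2) i) j
  -- Evaluation at a point is a ring homomorphism, so it carries the inverse over the algebra to a
  -- left inverse of `G y`, and such an inverse is unique.
  · have h1 : ((Matrix.of g)⁻¹).map (smoothEval y) * G y = 1 := by
      rw [← hmap y]
      have := (Matrix.map_mul (L := (Matrix.of g)⁻¹) (M := Matrix.of g)
        (f := (smoothEval y).toRingHom)).symm
      refine this.trans ?_
      rw [Matrix.nonsing_inv_mul _ hu]
      exact Matrix.map_one _ (map_zero _) (map_one _)
    exact congrFun (congrFun (Matrix.inv_eq_left_inv h1).symm i) j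

end Smooth

open Matrix

/-! ### Formal tensors evaluate to their coordinate expressions. -/

section Transport

variable {n : ℕ} {Ω : TopologicalSpace.Opens (Coord n)} {A : FormalMetric n (smoothFun Ω)}
  {G : MatField n} {k : Fin n → smoothFun Ω} {κ : Coord n → Fin n → ℝ}

theorem Represents.eval_d (hA : Represents A G) {f : smoothFun Ω} {F : Coord n → ℝ} (hF : Rep f F)
    (i : Fin n) (y : Ω) : smoothEval y (A.d i f) = pd i F y := by
  rw [hA.d_eq]; exact hF.pd i y

theorem Represents.rep_chr (hA : Represents A G) (i k j : Fin n) :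
    Rep (A.chr i k j) (christoffel G k i j) := fun y => by
  simp only [FormalMetric.chr, Matrix.of_apply, christoffel, map_smul, map_sum, map_mul, map_add,
    map_sub, hA.h_rep _ _ y, hA.eval_d (hA.g_rep _ _) _ y, smul_eq_mul]

theorem Represents.rep_rm (hA : Represents A G) (i j k l : Fin n) :
    Rep (A.rm i j k l) (riemann G i j k l) := fun y => by
  simp only [FormalMetric.rm, riemann, Matrix.add_apply, Matrix.sub_apply, mapD_apply,
    Matrix.mul_apply, map_sum, map_mul, map_add, map_sub, hA.rep_chr _ _ _ y,
    hA.eval_d (hA.rep_chr _ _ _) _ y, Finset.sum_sub_distrib]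

theorem Represents.rep_ric (hA : Represents A G) (i j : Fin n) :
    Rep (A.ric i j) (ricci G i j) := fun y => by
  simp only [FormalMetric.ric_apply, ricci, map_sum, hA.rep_rm _ _ _ _ y]

theorem Represents.rep_jt (hA : Represents A G) : Rep A.jt (schoutenTrace G) := fun y => by
  simp only [FormalMetric.jt, FormalMetric.scal, Matrix.trace, Matrix.diag, Matrix.mul_apply,
    schoutenTrace, map_smul, map_sum, map_mul, hA.h_rep _ _ y, smul_eq_mul]
  rw [div_eq_inv_mul]
  congr 1
  exact Finset.sum_congr rfl fun i _ => Finset.sum_congr rfl fun j _ => by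
    rw [A.ric_swap, hA.rep_ric]

theorem Represents.rep_sch (hA : Represents A G) (i j : Fin n) :
    Rep (A.sch i j) (schouten G i j) := fun y => by
  simp only [FormalMetric.sch, schouten, Matrix.smul_apply, Matrix.sub_apply, smul_eq_mul,
    map_smul, map_sub, map_mul, hA.rep_ric _ _ y, hA.rep_jt y, hA.g_rep _ _ y]
  rw [div_eq_inv_mul]

theorem Represents.rep_schUp (hA : Represents A G) (i j : Fin n) :
    Rep ((A.h *ᵥ A.sch i) j) (schoutenUp G i j) := fun y => by
  simp only [schoutenUp, mulVec, dotProduct, map_sum, map_mul, hA.h_rep _ _ y, hA.rep_sch _ _ y]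

theorem Represents.rep_nab (hA : Represents A G) (hk : ∀ i, Rep (k i) fun y => κ y i)
    (a b : Fin n) : Rep (A.nab k b a) (nablaVec G κ a b) := fun y => by
  simp only [FormalMetric.nab_apply, nablaVec, map_add, map_sum, map_mul, hA.rep_chr _ _ _ y,
    hA.eval_d (hk _) _ y, hk _ y]

theorem Represents.rep_nabLow (hA : Represents A G) (hk : ∀ i, Rep (k i) fun y => κ y i)
    (a b : Fin n) : Rep ((A.g * A.nab k) b a) (nablaVecLow G κ a b) := fun y => by
  simp only [nablaVecLow, Matrix.mul_apply, map_sum, map_mul, hA.g_rep _ _ y,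
    hA.rep_nab hk _ _ y]

theorem Represents.rep_divScal (hA : Represents A G) (hk : ∀ i, Rep (k i) fun y => κ y i) :
    Rep (A.divScal k) (splitScal G κ) := fun y => by
  simp only [FormalMetric.divScal, splitScal, divergence, map_smul, map_sum, hA.rep_nab hk _ _ y,
    smul_eq_mul]
  rw [div_eq_inv_mul]

theorem Represents.rep_skewSlot (hA : Represents A G) (hk : ∀ i, Rep (k i) fun y => κ y i)
    (a b : Fin n) : Rep (A.skewSlot k a b) (splitSkew G κ a b) := fun y => by
  simp only [FormalMetric.skewSlot, splitSkew, Matrix.smul_apply, Matrix.sub_apply,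
    Matrix.transpose_apply, map_smul, map_sub, hA.rep_nabLow hk _ _ y, smul_eq_mul]
  ring

theorem Represents.rep_nablaTwo (hA : Represents A G) (hk : ∀ i, Rep (k i) fun y => κ y i)
    (a b c : Fin n) : Rep (A.nablaTwo a (A.skewSlot k) b c)
      (nablaForm G (splitSkew G κ) a b c) := fun y => by
  simp only [FormalMetric.nablaTwo, nablaForm, Matrix.sub_apply, mapD_apply, Matrix.mul_apply,
    Matrix.transpose_apply, map_sub, map_sum, map_mul, hA.rep_chr _ _ _ y,
    hA.rep_skewSlot hk _ _ y, hA.eval_d (hA.rep_skewSlot hk _ _) _ y]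
  simp only [mul_comm]

theorem Represents.rep_formSlot (hA : Represents A G) (hk : ∀ i, Rep (k i) fun y => κ y i)
    (b : Fin n) : Rep (A.formSlot k b) (splitForm G κ b) := fun y => by
  simp only [FormalMetric.formSlot, splitForm, map_smul, map_sub, map_add, map_sum, map_mul,
    map_ofNat, hA.h_rep _ _ y, hA.g_rep _ _ y, hA.rep_sch _ _ y, hA.rep_jt y, hk _ y,
    hA.rep_nablaTwo hk _ _ _ y, hA.eval_d (hA.rep_divScal hk) _ y, smul_eq_mul]
  rw [div_eq_inv_mul]

/-- A tractor field over the algebra of smooth functions has the components `F`. -/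
structure RepT (V : smoothFun Ω × (Fin n → smoothFun Ω) × smoothFun Ω)
    (F : Coord n → Tractor n) : Prop where
  fst : Rep V.1 fun y => (F y).1
  mid : ∀ i, Rep (V.2.1 i) fun y => (F y).2.1 i
  lst : Rep V.2.2 fun y => (F y).2.2

/-- The tractor field with constant components. -/
def constT (V : Tractor n) : smoothFun Ω × (Fin n → smoothFun Ω) × smoothFun Ω :=
  (algebraMap ℝ _ V.1, fun i => algebraMap ℝ _ (V.2.1 i), algebraMap ℝ _ V.2.2)

theorem repT_constT (V : Tractor n) : RepT (constT (Ω := Ω) V) fun _ => V :=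
  ⟨fun _ => rfl, fun _ _ => rfl, fun _ => rfl⟩

variable {V W : smoothFun Ω × (Fin n → smoothFun Ω) × smoothFun Ω} {F H : Coord n → Tractor n}

theorem RepT.sub (hV : RepT V F) (hW : RepT W H) : RepT (V - W) (F - H) :=
  ⟨fun y => by rw [Prod.fst_sub, map_sub, hV.fst, hW.fst]; rfl,
    fun i y => by
      rw [Prod.snd_sub, Prod.fst_sub, Pi.sub_apply, map_sub, hV.mid, hW.mid]; rfl,
    fun y => by rw [Prod.snd_sub, Prod.snd_sub, map_sub, hV.lst, hW.lst]; rfl⟩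

theorem Represents.repT_nablaT (hA : Represents A G) (hV : RepT V F) (a : Fin n) :
    RepT (A.nablaT a V) (tractorNabla G a F) where
  fst y := by
    simp only [FormalMetric.nablaT, tractorNabla, dotProduct, map_sub, map_sum, map_mul,
      hA.g_rep _ _ y, hV.mid _ y, hA.eval_d hV.fst _ y]
  mid b y := by
    have h1 : smoothEval y (V.2.2 * (Pi.single a 1 : Fin n → smoothFun Ω) b)
        = if a = b then (F y).2.2 else 0 := by
      by_cases h : a = b
      · subst h; simp [hV.lst y]
      · rw [if_neg h, Pi.single_eq_of_ne (Ne.symm h), mul_zero, map_zero]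
    simp only [FormalMetric.nablaT, tractorNabla, Pi.add_apply, Pi.smul_apply, smul_eq_mul,
      map_add, h1]
    rw [map_mul, hA.rep_schUp a b y, hA.eval_d (hV.mid b) a y, hV.fst y]
    simp only [mulVec, dotProduct, map_sum, map_mul, hA.rep_chr _ _ _ y, hV.mid _ y]
    ring
  lst y := by
    simp only [FormalMetric.nablaT, tractorNabla, dotProduct, map_sub, map_sum, map_mul,
      hA.rep_sch _ _ y, hV.mid _ y, hA.eval_d hV.lst _ y]

theorem dotProduct_mulVec_eq_dot (G : MatField n) (y : Coord n) (v w : Fin n → ℝ) :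
    v ⬝ᵥ G y *ᵥ w = dot G y v w := by
  simp only [dotProduct, mulVec, dot, Finset.mul_sum]
  exact Finset.sum_congr rfl fun _ _ => Finset.sum_congr rfl fun _ _ => by ring

theorem Represents.eval_dot (hA : Represents A G) {v w : Fin n → smoothFun Ω}
    {v' w' : Fin n → ℝ} {y : Ω} (hv : ∀ i, smoothEval y (v i) = v' i)
    (hw : ∀ i, smoothEval y (w i) = w' i) : smoothEval y (v ⬝ᵥ A.g *ᵥ w) = dot G y v' w' := by
  rw [← dotProduct_mulVec_eq_dot]
  simp only [dotProduct, mulVec, map_sum, map_mul, hA.g_rep _ _ y, hv, hw]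

theorem Represents.rep_metricT (hA : Represents A G) (hV : RepT V F) (hW : RepT W H) :
    Rep (A.metricT V W) fun y => tractorMetric G y (F y) (H y) := fun y => by
  simp only [FormalMetric.metricT, tractorMetric, map_add, map_mul, hV.fst y, hV.lst y, hW.fst y,
    hW.lst y, hA.eval_dot (hV.mid · y) (hW.mid · y)]

theorem Represents.rep_evalT (hA : Represents A G) (hk : ∀ i, Rep (k i) fun y => κ y i)
    (hV : RepT V F) (hW : RepT W H) :
    Rep (A.evalT k V W) fun y => (splitting G κ y).eval G y (F y) (H y) := fun y => by
  have h1 : smoothEval y (W.2.1 ⬝ᵥ A.skewSlot k *ᵥ V.2.1)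
      = ∑ a, ∑ b, splitSkew G κ a b y * (H y).2.1 a * (F y).2.1 b := by
    simp only [dotProduct, mulVec, Finset.mul_sum, map_sum, map_mul, hA.rep_skewSlot hk _ _ y,
      hV.mid _ y, hW.mid _ y]
    exact Finset.sum_congr rfl fun _ _ => Finset.sum_congr rfl fun _ _ => by ring
  have h2 {v : Fin n → smoothFun Ω} {v' : Fin n → ℝ} (hv : ∀ i, smoothEval y (v i) = v' i) :
      smoothEval y (A.formSlot k ⬝ᵥ v) = ∑ a, splitForm G κ a y * v' a := by
    simp only [dotProduct, map_sum, map_mul, hA.rep_formSlot hk _ y, hv]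
  simp only [FormalMetric.evalT, TwoTractor.eval, splitting, map_add, map_sub, map_mul, h1,
    h2 (hV.mid · y), h2 (hW.mid · y), hA.eval_dot (hk · y) (hV.mid · y),
    hA.eval_dot (hk · y) (hW.mid · y), hV.fst y, hV.lst y, hW.fst y, hW.lst y,
    hA.rep_divScal hk y]

end Transport

/-! ### The tractor identities in local coordinates. -/

/-- A metric and a conformal Killing field in local coordinates on an open set. -/
structure LocalKilling {n : ℕ} (G : MatField n) (κ : Coord n → Fin n → ℝ)
    (Ω : TopologicalSpace.Opens (Coord n)) : Prop where
  smooth_metric : ∀ i j, ContDiffOn ℝ ∞ (fun y => G y i j) Ω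
  symm : ∀ y ∈ Ω, (G y).transpose = G y
  det_ne_zero : ∀ y ∈ Ω, (G y).det ≠ 0
  smooth_field : ∀ i, ContDiffOn ℝ ∞ (fun y => κ y i) Ω
  killing : ∀ y ∈ Ω, ∀ a b, (nablaVecLow G κ a b y + nablaVecLow G κ b a y) / 2
      = divergence G κ y / (n : ℝ) * G y a b

section LocalResults

variable {n : ℕ} {G : MatField n} {κ : Coord n → Fin n → ℝ} {Ω : TopologicalSpace.Opens (Coord n)}

/-- All formal identities enter the analysis here: the local data are realized over the algebra of
smooth functions, where the Killing equation is checked pointwise. -/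
theorem LocalKilling.exists_algebraic (h : LocalKilling G κ Ω) :
    ∃ (A : FormalMetric n (smoothFun Ω)) (k : Fin n → smoothFun Ω), Represents A G ∧
      (∀ i, Rep (k i) fun y => κ y i) ∧ A.IsKilling k (A.divScal k) := by
  obtain ⟨A, hA⟩ := exists_formalMetric h.smooth_metric h.symm h.det_ne_zero
  choose k hk using fun i => exists_rep (h.smooth_field i)
  refine ⟨A, k, hA, hk, ?_⟩
  ext1 a b
  refine smoothEval_ext fun y => ?_
  have h1 : ((A.nab k)ᵀ * A.g) a b = (A.g * A.nab k) b a := by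
    rw [← Matrix.transpose_apply (A.g * A.nab k), Matrix.transpose_mul, A.symm]
  have h2 := h.killing y y.2 a b
  rw [Matrix.add_apply, h1, Matrix.smul_apply, smul_eq_mul, map_add, map_mul, map_mul, map_ofNat,
    hA.rep_nabLow hk, hA.rep_nabLow hk, hA.rep_divScal hk, hA.g_rep, splitScal]
  linear_combination 2 * h2

/-- The prolonged conformal Killing equation in local coordinates. -/
theorem LocalKilling.pd_eval (h : LocalKilling G κ Ω) (hn : 3 ≤ n) {y : Coord n} (hy : y ∈ Ω)
    (a : Fin n) (V W : Tractor n) :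
    pd a (fun z => (splitting G κ z).eval G z V W) y
      = (splitting G κ y).eval G y (tractorNabla G a (fun _ => V) y) W
        + (splitting G κ y).eval G y V (tractorNabla G a (fun _ => W) y)
        - ∑ b, κ y b * tractorCurvatureForm G a b y V W := by
  obtain ⟨A, k, hA, hk, hK⟩ := h.exists_algebraic
  have hV := repT_constT (Ω := Ω) V
  have hW := repT_constT (Ω := Ω) W
  have h1 := congrArg (smoothEval ⟨y, hy⟩) (hK.d_evalT hn a (constT V) (constT W))
  rw [hA.eval_d (hA.rep_evalT hk hV hW) a, map_sub, map_add,
    hA.rep_evalT hk (hA.repT_nablaT hV a) hW, hA.rep_evalT hk hV (hA.repT_nablaT hW a)] at h1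
  rw [h1, map_sum]
  congr 1
  refine Finset.sum_congr rfl fun b _ => ?_
  rw [map_mul, hk, hA.rep_metricT hV ((hA.repT_nablaT (hA.repT_nablaT hW b) a).sub
    (hA.repT_nablaT (hA.repT_nablaT hW a) b))]
  rfl

/-- The tractor metric is parallel, in local coordinates. -/
theorem LocalKilling.pd_metric (h : LocalKilling G κ Ω) {y : Coord n} (hy : y ∈ Ω)
    (a : Fin n) (V W : Tractor n) :
    pd a (fun z => tractorMetric G z V W) y
      = tractorMetric G y (tractorNabla G a (fun _ => V) y) W
        + tractorMetric G y V (tractorNabla G a (fun _ => W) y) := by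
  obtain ⟨A, k, hA, hk, hK⟩ := h.exists_algebraic
  have hV := repT_constT (Ω := Ω) V
  have hW := repT_constT (Ω := Ω) W
  have h1 := congrArg (smoothEval ⟨y, hy⟩) (A.d_metricT a (constT V) (constT W))
  rwa [hA.eval_d (hA.rep_metricT hV hW) a, map_add,
    hA.rep_metricT (hA.repT_nablaT hV a) hW, hA.rep_metricT hV (hA.repT_nablaT hW a)] at h1

theorem LocalKilling.smooth_christoffel (h : LocalKilling G κ Ω) (k i j : Fin n) :
    ContDiffOn ℝ ∞ (christoffel G k i j) Ω := by
  obtain ⟨A, k, hA, hk, hK⟩ := h.exists_algebraic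
  exact (hA.rep_chr _ _ _).contDiffOn

theorem LocalKilling.smooth_schouten (h : LocalKilling G κ Ω) (i j : Fin n) :
    ContDiffOn ℝ ∞ (schouten G i j) Ω := by
  obtain ⟨A, k, hA, hk, hK⟩ := h.exists_algebraic
  exact (hA.rep_sch _ _).contDiffOn

theorem LocalKilling.smooth_schoutenUp (h : LocalKilling G κ Ω) (i j : Fin n) :
    ContDiffOn ℝ ∞ (schoutenUp G i j) Ω := by
  obtain ⟨A, k, hA, hk, hK⟩ := h.exists_algebraic
  exact (hA.rep_schUp _ _).contDiffOn

theorem LocalKilling.smooth_eval (h : LocalKilling G κ Ω) (V W : Tractor n) :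
    ContDiffOn ℝ ∞ (fun y => (splitting G κ y).eval G y V W) Ω := by
  obtain ⟨A, k, hA, hk, hK⟩ := h.exists_algebraic
  exact (hA.rep_evalT hk (repT_constT (Ω := Ω) V) (repT_constT (Ω := Ω) W)).contDiffOn

end LocalResults

/-! ### The tractor metric and elements of `Λ² T` as bilinear forms. -/

section Bilinear

variable {n : ℕ} (G : MatField n) (y : Coord n)

theorem dot_add_left (u v w : Fin n → ℝ) : dot G y (u + v) w = dot G y u w + dot G y v w := by
  simp only [dot, Pi.add_apply, mul_add, add_mul, Finset.sum_add_distrib]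

theorem dot_add_right (u v w : Fin n → ℝ) : dot G y u (v + w) = dot G y u v + dot G y u w := by
  simp only [dot, Pi.add_apply, mul_add, Finset.sum_add_distrib]

theorem dot_smul_left (c : ℝ) (u v : Fin n → ℝ) : dot G y (c • u) v = c * dot G y u v := by
  simp only [dot, Pi.smul_apply, smul_eq_mul, Finset.mul_sum]
  exact Finset.sum_congr rfl fun _ _ => Finset.sum_congr rfl fun _ _ => by ring

theorem dot_smul_right (c : ℝ) (u v : Fin n → ℝ) : dot G y u (c • v) = c * dot G y u v := by
  simp only [dot, Pi.smul_apply, smul_eq_mul, Finset.mul_sum]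
  exact Finset.sum_congr rfl fun _ _ => Finset.sum_congr rfl fun _ _ => by ring

theorem dot_zero_right (u : Fin n → ℝ) : dot G y u 0 = 0 := by
  simp [dot]

/-- The tractor metric as a bilinear form. -/
def metricBilin : Tractor n →ₗ[ℝ] Tractor n →ₗ[ℝ] ℝ :=
  LinearMap.mk₂ ℝ (tractorMetric G y)
    (fun V V' W => by
      simp only [tractorMetric, Prod.fst_add, Prod.snd_add, dot_add_left]; ring)
    (fun c V W => by
      simp only [tractorMetric, Prod.smul_fst, Prod.smul_snd, dot_smul_left, smul_eq_mul]; ring)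
    (fun V W W' => by
      simp only [tractorMetric, Prod.fst_add, Prod.snd_add, dot_add_right]; ring)
    (fun c V W => by
      simp only [tractorMetric, Prod.smul_fst, Prod.smul_snd, dot_smul_right, smul_eq_mul]; ring)

/-- An element of `Λ² T` as a bilinear form. -/
def evalBilin (K : TwoTractor n) : Tractor n →ₗ[ℝ] Tractor n →ₗ[ℝ] ℝ :=
  LinearMap.mk₂ ℝ (K.eval G y)
    (fun V V' W => by
      simp only [TwoTractor.eval, Prod.fst_add, Prod.snd_add, dot_add_right, Pi.add_apply, mul_add,
        Finset.sum_add_distrib]; ring)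
    (fun c V W => by
      have h1 : ∑ a, K.form a * (c • V.2.1) a = c * ∑ a, K.form a * V.2.1 a := by
        rw [Finset.mul_sum]
        exact Finset.sum_congr rfl fun _ _ => by simp only [Pi.smul_apply, smul_eq_mul]; ring
      have h2 : ∑ a, ∑ b, K.skew a b * W.2.1 a * (c • V.2.1) b
          = c * ∑ a, ∑ b, K.skew a b * W.2.1 a * V.2.1 b := by
        simp only [Finset.mul_sum]
        exact Finset.sum_congr rfl fun _ _ => Finset.sum_congr rfl fun _ _ => by
          simp only [Pi.smul_apply, smul_eq_mul]; ring
      simp only [TwoTractor.eval, Prod.smul_fst, Prod.smul_snd, dot_smul_right, h1, h2,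
        smul_eq_mul]; ring)
    (fun V W W' => by
      simp only [TwoTractor.eval, Prod.fst_add, Prod.snd_add, dot_add_right, Pi.add_apply, mul_add,
        add_mul, Finset.sum_add_distrib]; ring)
    (fun c V W => by
      have h1 : ∑ a, K.form a * (c • W.2.1) a = c * ∑ a, K.form a * W.2.1 a := by
        rw [Finset.mul_sum]
        exact Finset.sum_congr rfl fun _ _ => by simp only [Pi.smul_apply, smul_eq_mul]; ring
      have h2 : ∑ a, ∑ b, K.skew a b * (c • W.2.1) a * V.2.1 b
          = c * ∑ a, ∑ b, K.skew a b * W.2.1 a * V.2.1 b := by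
        simp only [Finset.mul_sum]
        exact Finset.sum_congr rfl fun _ _ => Finset.sum_congr rfl fun _ _ => by
          simp only [Pi.smul_apply, smul_eq_mul]; ring
      simp only [TwoTractor.eval, Prod.smul_fst, Prod.smul_snd, dot_smul_right, h1, h2,
        smul_eq_mul]; ring)

theorem metricBilin_apply (V W : Tractor n) : metricBilin G y V W = tractorMetric G y V W := rfl

theorem evalBilin_apply (K : TwoTractor n) (V W : Tractor n) :
    evalBilin G y K V W = K.eval G y V W := rfl

theorem tractorCurvatureForm_swap (a b : Fin n) (V W : Tractor n) :
    tractorCurvatureForm G a b y V W = -tractorCurvatureForm G b a y V W := by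
  simp only [tractorCurvatureForm, ← metricBilin_apply, ← map_neg]
  congr 1
  simp only [tractorCurvature, neg_sub]

end Bilinear

/-! ### Differentiation of tractors and bilinear forms along a curve. -/

section Curve

variable {n : ℕ} {G : MatField n} {x : ℝ → Coord n} {t : ℝ}

theorem hasDerivAt_comp_curve {F : Coord n → ℝ} (hF : DifferentiableAt ℝ F (x t))
    (hx : DifferentiableAt ℝ x t) :
    HasDerivAt (fun s => F (x s)) (∑ a, vel x t a * pd a F (x t)) t := by
  have h1 := hF.hasFDerivAt.comp_hasDerivAt t hx.hasDerivAt
  have h2 : deriv x t = ∑ a, vel x t a • EuclideanSpace.single a (1 : ℝ) := by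
    ext b
    have h3 : vel x t b = deriv x t b := by
      have := ((EuclideanSpace.proj b : Coord n →L[ℝ] ℝ).hasFDerivAt
        (x := x t)).comp_hasDerivAt t hx.hasDerivAt
      exact this.deriv
    rw [← h3]
    simp [Finset.sum_apply, Pi.single_apply]
  refine h1.congr_deriv ?_
  rw [h2, map_sum]
  simp [pd]

/-- The product rule for a field of bilinear forms along a curve. -/
theorem hasDerivAt_bilinear_curve (B : Coord n → Tractor n →ₗ[ℝ] Tractor n →ₗ[ℝ] ℝ)
    (hB : ∀ V W, DifferentiableAt ℝ (fun y => B y V W) (x t)) (hx : DifferentiableAt ℝ x t)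
    {V W : ℝ → Tractor n} {V' W' : Tractor n} (hV : HasDerivAt V V' t) (hW : HasDerivAt W W' t) :
    HasDerivAt (fun s => B (x s) (V s) (W s))
      (∑ a, vel x t a * pd a (fun y => B y (V t) (W t)) (x t)
        + B (x t) V' (W t) + B (x t) (V t) W') t := by
  -- Expanding in a fixed basis reduces the claim to the product rule for scalar functions, so
  -- differentiability of `B` is needed only on constant arguments.
  let e := Module.finBasis ℝ (Tractor n)
  let c (i) : Tractor n →L[ℝ] ℝ := LinearMap.toContinuousLinearMap (e.coord i)
  have hexp (y : Coord n) (X Y : Tractor n) :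
      B y X Y = ∑ i, ∑ j, c i X * c j Y * B y (e i) (e j) := by
    conv_lhs => rw [← e.sum_repr X, ← e.sum_repr Y]
    simp only [map_sum, LinearMap.sum_apply, map_smul, LinearMap.smul_apply, smul_eq_mul, Finset.mul_sum]
    rw [Finset.sum_comm]
    exact Finset.sum_congr rfl fun i _ => Finset.sum_congr rfl fun j _ => by
      simp only [c, LinearMap.coe_toContinuousLinearMap', Module.Basis.coord_apply]; ring
  have hpd : ∑ a, vel x t a * pd a (fun y => B y (V t) (W t)) (x t)
      = ∑ i, ∑ j, c i (V t) * c j (W t) * ∑ a, vel x t a * pd a (fun y => B y (e i) (e j)) (x t)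
      := by
    have h1 := hasDerivAt_comp_curve (hB (V t) (W t)) hx
    refine h1.unique ?_
    simp only [hexp _ (V t) (W t)]
    exact HasDerivAt.fun_sum fun i _ => HasDerivAt.fun_sum fun j _ =>
      (hasDerivAt_comp_curve (hB (e i) (e j)) hx).const_mul _
  have hc (i) {X : ℝ → Tractor n} {X' : Tractor n} (hX : HasDerivAt X X' t) :
      HasDerivAt (fun s => c i (X s)) (c i X') t :=
    (c i).hasFDerivAt.comp_hasDerivAt t hX
  have hfun : (fun s => B (x s) (V s) (W s))
      = fun s => ∑ i, ∑ j, c i (V s) * c j (W s) * B (x s) (e i) (e j) :=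
    funext fun s => hexp _ _ _
  rw [hfun, hpd, hexp _ V', hexp _ (V t)]
  simp only [← Finset.sum_add_distrib]
  refine HasDerivAt.fun_sum fun i _ => HasDerivAt.fun_sum fun j _ => ?_
  refine (((hc i hV).fun_mul (hc j hW)).fun_mul
    (hasDerivAt_comp_curve (hB (e i) (e j)) hx)).congr_deriv ?_
  ring

/-- On a tractor field with constant components only the algebraic part of the connection survives.
Subtracting that part from the covariant derivative leaves the derivative of the components, so the
identities for constant tractors suffice along curves. -/
theorem ddtTractor_eq (V : ℝ → Tractor n) (hV : DifferentiableAt ℝ V t) :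
    HasDerivAt V (ddtTractor G x V t
      - ∑ a, vel x t a • tractorNabla G a (fun _ => V t) (x t)) t := by
  have h1 : HasDerivAt V (deriv (fun s => (V s).1) t, fun b => deriv (fun s => (V s).2.1 b) t,
      deriv (fun s => (V s).2.2) t) t := by
    refine hV.fst.hasDerivAt.prodMk (HasDerivAt.prodMk ?_ hV.snd.snd.hasDerivAt)
    exact hasDerivAt_pi.2 fun b => (differentiableAt_pi.1 hV.snd.fst b).hasDerivAt
  have hc (a : Fin n) (r : ℝ) : pd a (fun _ => r) (x t) = 0 := by simp [pd]
  refine h1.congr_deriv (Eq.symm ?_)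
  rw [sub_eq_iff_eq_add]
  refine Prod.ext ?_ (Prod.ext ?_ ?_)
  · rw [Prod.fst_add, Prod.fst_sum]
    simp only [ddtTractor, tractorNabla, Prod.smul_fst, hc, smul_eq_mul, zero_sub, mul_neg,
      Finset.sum_neg_distrib, dot, Finset.mul_sum]
    rw [sub_eq_add_neg]
    congr 2
    exact Finset.sum_congr rfl fun _ _ => Finset.sum_congr rfl fun _ _ => by ring
  · rw [Prod.snd_add, Prod.fst_add, Prod.snd_sum, Prod.fst_sum]
    ext b
    simp only [ddtTractor, tractorNabla, Prod.smul_fst, Prod.smul_snd, hc, smul_eq_mul, zero_add,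
      Pi.add_apply, Finset.sum_apply, Pi.smul_apply, mul_add, Finset.sum_add_distrib, mul_ite,
      mul_zero, Finset.sum_ite_eq', Finset.mem_univ, if_true, Finset.sum_mul, Finset.mul_sum]
    rw [← add_assoc, ← add_assoc]
    congr 1
    · congr 2
      exact Finset.sum_congr rfl fun _ _ => Finset.sum_congr rfl fun _ _ => by ring
    · exact Finset.sum_congr rfl fun _ _ => by ring
  · rw [Prod.snd_add, Prod.snd_add, Prod.snd_sum, Prod.snd_sum]
    simp only [ddtTractor, tractorNabla, Prod.smul_snd, hc, smul_eq_mul, zero_sub, mul_neg,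
      Finset.sum_neg_distrib, Finset.mul_sum]
    rw [sub_eq_add_neg]
    congr 2
    exact Finset.sum_congr rfl fun _ _ => Finset.sum_congr rfl fun _ _ => by ring

variable {κ : Coord n → Fin n → ℝ} {Ω : TopologicalSpace.Opens (Coord n)}

/-- The tractor metric is parallel along curves. -/
theorem LocalKilling.hasDerivAt_metric (h : LocalKilling G κ Ω) (hxt : x t ∈ Ω)
    (hx : DifferentiableAt ℝ x t) {V W : ℝ → Tractor n} (hV : DifferentiableAt ℝ V t)
    (hW : DifferentiableAt ℝ W t) :
    HasDerivAt (fun s => tractorMetric G (x s) (V s) (W s))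
      (tractorMetric G (x t) (ddtTractor G x V t) (W t)
        + tractorMetric G (x t) (V t) (ddtTractor G x W t)) t := by
  have hG (i j) : DifferentiableAt ℝ (fun y => G y i j) (x t) :=
    ((h.smooth_metric i j).differentiableOn (by simp)).differentiableAt (Ω.isOpen.mem_nhds hxt)
  have hB (V W : Tractor n) : DifferentiableAt ℝ (fun y => metricBilin G y V W) (x t) := by
    simp only [metricBilin_apply, tractorMetric, dot]
    fun_prop
  have h1 := hasDerivAt_bilinear_curve (metricBilin G) hB hx (ddtTractor_eq (G := G) (x := x) V hV)
    (ddtTractor_eq (G := G) (x := x) W hW)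
  have hp (a : Fin n) : pd a (fun y => metricBilin G y (V t) (W t)) (x t)
      = metricBilin G (x t) (tractorNabla G a (fun _ => V t) (x t)) (W t)
        + metricBilin G (x t) (V t) (tractorNabla G a (fun _ => W t) (x t)) :=
    h.pd_metric hxt a (V t) (W t)
  refine h1.congr_deriv ?_
  simp only [hp, ← metricBilin_apply, map_sub, map_sum, map_smul, LinearMap.sub_apply,
    LinearMap.sum_apply, LinearMap.smul_apply, smul_eq_mul, mul_add, Finset.sum_add_distrib]
  ring

/-- The derivative along a curve of the splitting of a conformal Killing field. -/
theorem LocalKilling.hasDerivAt_eval (h : LocalKilling G κ Ω) (hn : 3 ≤ n) (hxt : x t ∈ Ω)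
    (hx : DifferentiableAt ℝ x t) {V W : ℝ → Tractor n} (hV : DifferentiableAt ℝ V t)
    (hW : DifferentiableAt ℝ W t) :
    HasDerivAt (fun s => (splitting G κ (x s)).eval G (x s) (V s) (W s))
      ((splitting G κ (x t)).eval G (x t) (ddtTractor G x V t) (W t)
        + (splitting G κ (x t)).eval G (x t) (V t) (ddtTractor G x W t)
        + ∑ a, κ (x t) a * ∑ b, vel x t b * tractorCurvatureForm G a b (x t) (V t) (W t)) t := by
  have hB (V W : Tractor n) :
      DifferentiableAt ℝ (fun y => evalBilin G y (splitting G κ y) V W) (x t) :=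
    ((h.smooth_eval V W).differentiableOn (by simp)).differentiableAt (Ω.isOpen.mem_nhds hxt)
  have h1 := hasDerivAt_bilinear_curve (fun y => evalBilin G y (splitting G κ y)) hB hx
    (ddtTractor_eq (G := G) (x := x) V hV) (ddtTractor_eq (G := G) (x := x) W hW)
  refine h1.congr_deriv ?_
  have hp (a : Fin n) : pd a (fun y => evalBilin G y (splitting G κ y) (V t) (W t)) (x t)
      = evalBilin G (x t) (splitting G κ (x t)) (tractorNabla G a (fun _ => V t) (x t)) (W t)
        + evalBilin G (x t) (splitting G κ (x t)) (V t) (tractorNabla G a (fun _ => W t) (x t))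
        - ∑ b, κ (x t) b * tractorCurvatureForm G a b (x t) (V t) (W t) :=
    h.pd_eval hn hxt a (V t) (W t)
  -- Exchanging the two form indices of the curvature turns `-U^a k^b Ω_{ab}` into `k^a U^b Ω_{ab}`,
  -- the contraction that defines `ℓ`.
  have h2 : ∑ a, κ (x t) a * ∑ b, vel x t b * tractorCurvatureForm G a b (x t) (V t) (W t)
      = -∑ a, vel x t a * ∑ b, κ (x t) b * tractorCurvatureForm G a b (x t) (V t) (W t) := by
    simp only [Finset.mul_sum, ← Finset.sum_neg_distrib]
    rw [Finset.sum_comm]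
    exact Finset.sum_congr rfl fun a _ => Finset.sum_congr rfl fun b _ => by
      rw [tractorCurvatureForm_swap]; ring
  simp only [h2, hp, ← evalBilin_apply, map_sub, map_sum, map_smul, LinearMap.sub_apply,
    LinearMap.sum_apply, LinearMap.smul_apply, smul_eq_mul, mul_add, mul_sub,
    Finset.sum_add_distrib, Finset.sum_sub_distrib]
  ring

end Curve

/-! ### Conformal circles and the derivatives of their canonical lift. -/

/-- A smooth nowhere null curve in local coordinates. -/
structure LocalCurve {n : ℕ} (G : MatField n) (Ω : TopologicalSpace.Opens (Coord n))
    (x : ℝ → Coord n) (J : Set ℝ) : Prop where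
  isOpen : IsOpen J
  smooth : ContDiffOn ℝ ∞ x J
  mapsTo : Set.MapsTo x J Ω
  nonnull : ∀ t ∈ J, dot G (x t) (vel x t) (vel x t) ≠ 0

section Curve

variable {n : ℕ} {G : MatField n} {κ : Coord n → Fin n → ℝ} {Ω : TopologicalSpace.Opens (Coord n)}
  {x : ℝ → Coord n} {J : Set ℝ} {t : ℝ}

theorem contDiffOn_deriv_of_isOpen {f : ℝ → ℝ} (hJ : IsOpen J) (hf : ContDiffOn ℝ ∞ f J) :
    ContDiffOn ℝ ∞ (fun t => deriv f t) J :=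
  hf.deriv_of_isOpen hJ (by simp)

namespace LocalCurve

theorem comp (c : LocalCurve G Ω x J) {F : Coord n → ℝ} (hF : ContDiffOn ℝ ∞ F Ω) :
    ContDiffOn ℝ ∞ (fun t => F (x t)) J := hF.comp c.smooth c.mapsTo

theorem smooth_vel (c : LocalCurve G Ω x J) (a : Fin n) : ContDiffOn ℝ ∞ (fun t => vel x t a) J :=
  contDiffOn_deriv_of_isOpen c.isOpen
    ((EuclideanSpace.proj a : Coord n →L[ℝ] ℝ).contDiff.comp_contDiffOn c.smooth)

theorem smooth_dot (c : LocalCurve G Ω x J) (h : LocalKilling G κ Ω) {v w : ℝ → Fin n → ℝ}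
    (hv : ∀ i, ContDiffOn ℝ ∞ (fun t => v t i) J) (hw : ∀ i, ContDiffOn ℝ ∞ (fun t => w t i) J) :
    ContDiffOn ℝ ∞ (fun t => dot G (x t) (v t) (w t)) J :=
  ContDiffOn.sum fun i _ => ContDiffOn.sum fun j _ =>
    ((c.comp (h.smooth_metric i j)).mul (hv i)).mul (hw j)

theorem smooth_ddtVec (c : LocalCurve G Ω x J) (h : LocalKilling G κ Ω) {v : ℝ → Fin n → ℝ}
    (hv : ∀ i, ContDiffOn ℝ ∞ (fun t => v t i) J) (i : Fin n) :
    ContDiffOn ℝ ∞ (fun t => ddtVec G x v t i) J :=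
  (contDiffOn_deriv_of_isOpen c.isOpen (hv i)).add <|
    ContDiffOn.sum fun a _ => ContDiffOn.sum fun b _ =>
      ((c.comp (h.smooth_christoffel i a b)).mul (c.smooth_vel a)).mul (hv b)

theorem smooth_ddtTractor (c : LocalCurve G Ω x J) (h : LocalKilling G κ Ω) {V : ℝ → Tractor n}
    (hV : ContDiffOn ℝ ∞ V J) : ContDiffOn ℝ ∞ (ddtTractor G x V) J := by
  have h2 (i : Fin n) : ContDiffOn ℝ ∞ (fun t => (V t).2.1 i) J :=
    contDiffOn_pi.1 hV.snd.fst i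
  refine ContDiffOn.prodMk ?_ (ContDiffOn.prodMk (contDiffOn_pi.2 fun b => ?_) ?_)
  · exact (contDiffOn_deriv_of_isOpen c.isOpen hV.fst).sub (c.smooth_dot h c.smooth_vel h2)
  · refine (((contDiffOn_deriv_of_isOpen c.isOpen (h2 b)).add ?_).add
      ((c.smooth_vel b).mul hV.snd.snd)).add (ContDiffOn.mul ?_ hV.fst)
    · exact ContDiffOn.sum fun a _ => ContDiffOn.sum fun d _ =>
        ((c.comp (h.smooth_christoffel b a d)).mul (c.smooth_vel a)).mul (h2 d)
    · exact ContDiffOn.sum fun a _ => (c.smooth_vel a).mul (c.comp (h.smooth_schoutenUp a b))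
  · refine (contDiffOn_deriv_of_isOpen c.isOpen hV.snd.snd).sub ?_
    exact ContDiffOn.sum fun a _ => ContDiffOn.sum fun d _ =>
      ((c.comp (h.smooth_schouten a d)).mul (c.smooth_vel a)).mul (h2 d)

theorem speed_ne_zero (c : LocalCurve G Ω x J) (ht : t ∈ J) : speed G x t ≠ 0 :=
  (Real.sqrt_pos.2 (abs_pos.2 (c.nonnull t ht))).ne'

theorem smooth_speed_inv (c : LocalCurve G Ω x J) (h : LocalKilling G κ Ω) :
    ContDiffOn ℝ ∞ (fun t => (speed G x t)⁻¹) J := by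
  refine ContDiffOn.inv ?_ fun t ht => c.speed_ne_zero ht
  have h1 : ContDiffOn ℝ ∞ (fun t => |dot G (x t) (vel x t) (vel x t)|) J := fun t ht =>
    (c.smooth_dot h c.smooth_vel c.smooth_vel t ht).abs (c.nonnull t ht)
  exact h1.sqrt fun t ht => (abs_pos.2 (c.nonnull t ht)).ne'

theorem smooth_tractorT (c : LocalCurve G Ω x J) (h : LocalKilling G κ Ω) :
    ContDiffOn ℝ ∞ (tractorT G x) J :=
  contDiffOn_const.prodMk (contDiffOn_const.prodMk (c.smooth_speed_inv h))

theorem smooth_tractorU (c : LocalCurve G Ω x J) (h : LocalKilling G κ Ω) :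
    ContDiffOn ℝ ∞ (tractorU G x) J := c.smooth_ddtTractor h (c.smooth_tractorT h)

theorem smooth_tractorU' (c : LocalCurve G Ω x J) (h : LocalKilling G κ Ω) :
    ContDiffOn ℝ ∞ (tractorU' G x) J := c.smooth_ddtTractor h (c.smooth_tractorU h)

theorem differentiableAt {E : Type*} [NormedAddCommGroup E] [NormedSpace ℝ E]
    (c : LocalCurve G Ω x J) {f : ℝ → E} (hf : ContDiffOn ℝ ∞ f J)
    (ht : t ∈ J) : DifferentiableAt ℝ f t :=
  (hf.differentiableOn (by simp)).differentiableAt (c.isOpen.mem_nhds ht)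

theorem hasDerivAt_metric (c : LocalCurve G Ω x J) (h : LocalKilling G κ Ω) (ht : t ∈ J)
    {V W : ℝ → Tractor n} (hV : ContDiffOn ℝ ∞ V J) (hW : ContDiffOn ℝ ∞ W J) :
    HasDerivAt (fun s => tractorMetric G (x s) (V s) (W s))
      (tractorMetric G (x t) (ddtTractor G x V t) (W t)
        + tractorMetric G (x t) (V t) (ddtTractor G x W t)) t :=
  h.hasDerivAt_metric (c.mapsTo ht) (c.differentiableAt c.smooth ht) (c.differentiableAt hV ht)
    (c.differentiableAt hW ht)

end LocalCurve

theorem tractorU_eq (t : ℝ) :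
    tractorU G x t = (0, (speed G x t)⁻¹ • vel x t, deriv (fun s => (speed G x s)⁻¹) t) := by
  refine Prod.ext ?_ (Prod.ext ?_ ?_)
  · simp [tractorU, ddtTractor, tractorT, dot]
  · ext b; simp [tractorU, ddtTractor, tractorT, mul_comm]
  · simp [tractorU, ddtTractor, tractorT]

theorem tractorMetric_comm (hG : (G (x t)).transpose = G (x t)) (V W : Tractor n) :
    tractorMetric G (x t) V W = tractorMetric G (x t) W V := by
  have h1 (v w : Fin n → ℝ) : dot G (x t) v w = dot G (x t) w v := by
    rw [dot, Finset.sum_comm]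
    refine Finset.sum_congr rfl fun i _ => Finset.sum_congr rfl fun j _ => ?_
    rw [show G (x t) j i = G (x t) i j from congrFun (congrFun hG i) j]; ring
  rw [tractorMetric, tractorMetric, h1]; ring

namespace LocalCurve

theorem tractorU'_fst (_c : LocalCurve G Ω x J) (t : ℝ) :
    (tractorU' G x t).1 = -((speed G x t)⁻¹ * dot G (x t) (vel x t) (vel x t)) := by
  simp only [tractorU', ddtTractor, tractorU_eq, deriv_const, dot_smul_right, zero_sub]

theorem tractorU'_mid (c : LocalCurve G Ω x J) (h : LocalKilling G κ Ω) (ht : t ∈ J) :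
    (tractorU' G x t).2.1 = (2 * deriv (fun s => (speed G x s)⁻¹) t) • vel x t
      + (speed G x t)⁻¹ • acc G x t := by
  ext b
  have h1 : deriv (fun s => (speed G x s)⁻¹ * vel x s b) t
      = deriv (fun s => (speed G x s)⁻¹) t * vel x t b
        + (speed G x t)⁻¹ * deriv (fun s => vel x s b) t :=
    deriv_fun_mul (c.differentiableAt (c.smooth_speed_inv h) ht)
      (c.differentiableAt (c.smooth_vel b) ht)
  have h2 : ∑ i, ∑ j, christoffel G b i j (x t) * vel x t i * ((speed G x t)⁻¹ * vel x t j)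
      = (speed G x t)⁻¹ * ∑ i, ∑ j, christoffel G b i j (x t) * vel x t i * vel x t j := by
    simp only [Finset.mul_sum]
    exact Finset.sum_congr rfl fun _ _ => Finset.sum_congr rfl fun _ _ => by ring
  simp only [tractorU', ddtTractor, tractorU_eq, h1, h2, acc, ddtVec, Pi.add_apply, Pi.smul_apply,
    smul_eq_mul]
  ring

/-- The differentiated function is `⟨U, U⟩ = N / |N|` with `N = U_c U^c`. It is locally constant
because the sign of the nonvanishing continuous `N` is, whatever the signature. -/
theorem hasDerivAt_metric_tractorU (c : LocalCurve G Ω x J) (h : LocalKilling G κ Ω)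
    (ht : t ∈ J) :
    HasDerivAt (fun s => (speed G x s)⁻¹ * ((speed G x s)⁻¹ * dot G (x s) (vel x s) (vel x s)))
      0 t := by
  have hs (s : ℝ) : speed G x s * speed G x s = |dot G (x s) (vel x s) (vel x s)| :=
    Real.mul_self_sqrt (abs_nonneg _)
  have hc : ContinuousAt (fun s => dot G (x s) (vel x s) (vel x s)) t :=
    (c.differentiableAt (c.smooth_dot h c.smooth_vel c.smooth_vel) ht).continuousAt
  rcases lt_or_gt_of_ne (c.nonnull t ht) with hneg | hpos
  · refine (hasDerivAt_const t (-1 : ℝ)).congr_of_eventuallyEq ?_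
    filter_upwards [hc.eventually_lt continuousAt_const hneg] with s hlt
    rw [← mul_assoc, ← mul_inv, hs, abs_of_neg hlt, inv_neg, neg_mul, inv_mul_cancel₀ hlt.ne]
  · refine (hasDerivAt_const t (1 : ℝ)).congr_of_eventuallyEq ?_
    filter_upwards [continuousAt_const.eventually_lt hc hpos] with s hlt
    rw [← mul_assoc, ← mul_inv, hs, abs_of_pos hlt, inv_mul_cancel₀ hlt.ne']

/-- Differentiate the locally constant `⟨U, U⟩`, using that the tractor metric is parallel and
symmetric. -/
theorem metric_U_U' (c : LocalCurve G Ω x J) (h : LocalKilling G κ Ω) (ht : t ∈ J) :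
    tractorMetric G (x t) (tractorU G x t) (tractorU' G x t) = 0 := by
  have h1 := c.hasDerivAt_metric h ht (c.smooth_tractorU h) (c.smooth_tractorU h)
  have h2 : (fun s => tractorMetric G (x s) (tractorU G x s) (tractorU G x s))
      = fun s => (speed G x s)⁻¹ * ((speed G x s)⁻¹ * dot G (x s) (vel x s) (vel x s)) := by
    ext s
    simp only [tractorU_eq, tractorMetric, dot_smul_left, dot_smul_right]
    ring
  rw [h2] at h1
  have h3 := h1.unique (c.hasDerivAt_metric_tractorU h ht)
  rw [tractorMetric_comm (h.symm _ (c.mapsTo ht)) (ddtTractor G x (tractorU G x) t)] at h3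
  rw [tractorU']
  linarith

/-- The third derivative of the canonical lift of a conformal circle with a projective parameter
vanishes. -/
theorem ddtTractor_tractorU' (c : LocalCurve G Ω x J) (h : LocalKilling G κ Ω)
    (hcircle : ∀ t ∈ J, CircleEquation G x t)
    (hproj : ∀ t ∈ J, tractorMetric G (x t) (tractorU' G x t) (tractorU' G x t) = 0)
    (ht : t ∈ J) : ddtTractor G x (tractorU' G x) t = 0 := by
  have hw0 : (speed G x t)⁻¹ ≠ 0 := inv_ne_zero (c.speed_ne_zero ht)
  have hN0 := c.nonnull t ht
  have hUU' := c.metric_U_U' h ht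
  have hmem := c.isOpen.mem_nhds ht
  set X := ddtTractor G x (tractorU' G x) t with hX
  -- the first slot
  have hfst : X.1 = 0 := by
    -- Pairing with `T` reads off the first slot. Since `⟨T, U'⟩ = -⟨U, U⟩` is locally constant, its
    -- derivative `⟨U, U'⟩ + ⟨T, X⟩` vanishes, and `⟨U, U'⟩ = 0`.
    have h1 := c.hasDerivAt_metric h ht (c.smooth_tractorT h) (c.smooth_tractorU' h)
    have h2 : (fun s => tractorMetric G (x s) (tractorT G x s) (tractorU' G x s)) = fun s =>
        -((speed G x s)⁻¹ * ((speed G x s)⁻¹ * dot G (x s) (vel x s) (vel x s))) := by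
      ext s
      have : dot G (x s) 0 (tractorU' G x s).2.1 = 0 := by simp [dot]
      have h0 : (tractorT G x s).2.1 = 0 := rfl
      rw [tractorMetric, h0, this, c.tractorU'_fst]
      simp [tractorT]
    rw [h2] at h1
    have h3 := h1.unique (c.hasDerivAt_metric_tractorU h ht).neg
    have h4 : tractorMetric G (x t) (tractorT G x t) X = (speed G x t)⁻¹ * X.1 := by
      have : dot G (x t) 0 X.2.1 = 0 := by simp [dot]
      have h0 : (tractorT G x t).2.1 = 0 := rfl
      rw [tractorMetric, h0, this]
      simp [tractorT]
    rw [← hX, h4, show ddtTractor G x (tractorT G x) t = tractorU G x t from rfl, hUU'] at h3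
    have h5 : (speed G x t)⁻¹ * X.1 = 0 := by linarith
    exact (mul_eq_zero.1 h5).resolve_left hw0
  -- the derivatives of the metric relations
  have hUX : tractorMetric G (x t) (tractorU G x t) X = 0 := by
    have h1 := c.hasDerivAt_metric h ht (c.smooth_tractorU h) (c.smooth_tractorU' h)
    have h2 := h1.unique ((hasDerivAt_const t (0 : ℝ)).congr_of_eventuallyEq (by
      filter_upwards [hmem] with s hs using c.metric_U_U' h hs))
    rw [show ddtTractor G x (tractorU G x) t = tractorU' G x t from rfl, hproj t ht] at h2
    linarith
  have hU'X : tractorMetric G (x t) (tractorU' G x t) X = 0 := by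
    have h1 := c.hasDerivAt_metric h ht (c.smooth_tractorU' h) (c.smooth_tractorU' h)
    have h2 := h1.unique ((hasDerivAt_const t (0 : ℝ)).congr_of_eventuallyEq (by
      filter_upwards [hmem] with s hs using hproj s hs))
    rw [tractorMetric_comm (h.symm _ (c.mapsTo ht)) (ddtTractor G x (tractorU' G x) t)] at h2
    linarith
  -- the middle slot
  set w := (speed G x t)⁻¹ with hw
  set w₁ := deriv (fun s => (speed G x s)⁻¹) t with hw₁
  set N := dot G (x t) (vel x t) (vel x t) with hN
  -- This is `⟨U, U'⟩ = 0` written in slots. It turns the coefficient `3 w₁` of the acceleration in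
  -- `X` into the coefficient occurring in the circle equation.
  have hw₁N : w₁ = -(w * (N⁻¹ * dot G (x t) (vel x t) (acc G x t))) := by
    have h1 : w * (w₁ * N + w * dot G (x t) (vel x t) (acc G x t)) = 0 := by
      rw [← hUU']
      simp only [tractorMetric, c.tractorU'_fst, c.tractorU'_mid h ht, tractorU_eq, dot_smul_left,
        dot_smul_right, dot_add_right, ← hw, ← hw₁, ← hN]
      ring
    have h2 := (mul_eq_zero.1 h1).resolve_left hw0
    field_simp
    linarith
  obtain ⟨z, hz⟩ : ∃ z : ℝ, X.2.1 = z • vel x t := by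
    -- A non-null velocity has a nonzero component, and dividing by it turns `U ∧ Z = 0` into
    -- proportionality of `Z` to `U`.
    obtain ⟨a, ha⟩ : ∃ a, vel x t a ≠ 0 := by
      by_contra! hall
      exact hN0 (by simp [hN, dot, hall])
    have hcirc := hcircle t ht
    simp only [CircleEquation] at hcirc
    rw [← hN] at hcirc
    set Z : Fin n → ℝ := fun b => jerk G x t b
      - 3 * N⁻¹ * dot G (x t) (vel x t) (acc G x t) * acc G x t b
      - N * ∑ d, vel x t d * schoutenUp G d b (x t) with hZ
    have hZa (b : Fin n) : Z b = (Z a / vel x t a) * vel x t b := by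
      have := hcirc a b
      field_simp
      linear_combination this
    -- The middle slot of `X` is `(2 w'' + ρ) U + w Z`, where `ρ` is the last slot of `U'` and `Z`
    -- is the vector in the circle equation.
    refine ⟨2 * deriv (fun s => deriv (fun r => (speed G x r)⁻¹) s) t + (tractorU' G x t).2.2
      + w * (Z a / vel x t a), ?_⟩
    ext b
    have hd1 := c.differentiableAt (contDiffOn_deriv_of_isOpen c.isOpen (c.smooth_speed_inv h)) ht
    have hd2 := c.differentiableAt (c.smooth_vel b) ht
    have hd3 := c.differentiableAt (c.smooth_speed_inv h) ht
    have hd4 := c.differentiableAt (c.smooth_ddtVec h c.smooth_vel b) ht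
    have h1 : deriv (fun s => (tractorU' G x s).2.1 b) t
        = 2 * deriv (fun s => deriv (fun r => (speed G x r)⁻¹) s) t * vel x t b
          + 2 * w₁ * deriv (fun s => vel x s b) t
          + (w₁ * acc G x t b + w * deriv (fun s => acc G x s b) t) := by
      have he : (fun s => (tractorU' G x s).2.1 b) =ᶠ[nhds t] fun s =>
          2 * deriv (fun r => (speed G x r)⁻¹) s * vel x s b
            + (speed G x s)⁻¹ * acc G x s b := by
        filter_upwards [hmem] with s hs
        rw [c.tractorU'_mid h hs]; rfl
      rw [he.deriv_eq]
      exact (((hd1.hasDerivAt.const_mul 2).fun_mul hd2.hasDerivAt).fun_add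
        (hd3.hasDerivAt.fun_mul hd4.hasDerivAt)).deriv
    have h2 : ∑ i, ∑ j, christoffel G b i j (x t) * vel x t i * ((2 * w₁) • vel x t
          + w • acc G x t) j
        = 2 * w₁ * (∑ i, ∑ j, christoffel G b i j (x t) * vel x t i * vel x t j)
          + w * ∑ i, ∑ j, christoffel G b i j (x t) * vel x t i * acc G x t j := by
      simp only [Finset.mul_sum, Pi.add_apply, Pi.smul_apply, smul_eq_mul,
        ← Finset.sum_add_distrib]
      exact Finset.sum_congr rfl fun _ _ => Finset.sum_congr rfl fun _ _ => by ring
    have h3 : acc G x t b = deriv (fun s => vel x s b) t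
        + ∑ i, ∑ j, christoffel G b i j (x t) * vel x t i * vel x t j := rfl
    have h4 : jerk G x t b = deriv (fun s => acc G x s b) t
        + ∑ i, ∑ j, christoffel G b i j (x t) * vel x t i * acc G x t j := rfl
    have h5 : X.2.1 b = deriv (fun s => (tractorU' G x s).2.1 b) t
        + (∑ i, ∑ j, christoffel G b i j (x t) * vel x t i * (tractorU' G x t).2.1 j)
        + vel x t b * (tractorU' G x t).2.2
        + (∑ i, vel x t i * schoutenUp G i b (x t)) * (tractorU' G x t).1 := rfl
    have h6 := hZa b
    simp only [hZ] at h6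
    rw [h5, h1, c.tractorU'_mid h ht, ← hw, ← hw₁, h2, c.tractorU'_fst, ← hw, ← hN, Pi.smul_apply,
      smul_eq_mul]
    linear_combination w * h6 - 2 * w₁ * h3 - w * h4 + 3 * acc G x t b * hw₁N
  -- With zero first slot, `⟨U, X⟩ = w z N`. Once `z = 0`, the pairing `⟨U', X⟩` is `-w N` times the
  -- last slot of `X`.
  have hz0 : z = 0 := by
    rw [tractorMetric, tractorU_eq, hfst, hz] at hUX
    simp only [dot_smul_left, dot_smul_right, ← hN, ← hw] at hUX
    have h1 : w * (z * N) = 0 := by linarith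
    exact (mul_eq_zero.1 ((mul_eq_zero.1 h1).resolve_left hw0)).resolve_right hN0
  have hmid : X.2.1 = 0 := by rw [hz, hz0, zero_smul]
  have hlst : X.2.2 = 0 := by
    rw [tractorMetric, hfst, hmid, dot_zero_right, c.tractorU'_fst, ← hw, ← hN] at hU'X
    have h1 : w * N * X.2.2 = 0 := by linarith
    exact (mul_eq_zero.1 h1).resolve_left (mul_ne_zero hw0 hN0)
  exact Prod.ext hfst (Prod.ext hmid hlst)

/-- Conservation along conformal circles, in local coordinates. -/
theorem hasDerivAt_eval (c : LocalCurve G Ω x J) (h : LocalKilling G κ Ω) (hn : 3 ≤ n)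
    (hcircle : ∀ t ∈ J, CircleEquation G x t)
    (hproj : ∀ t ∈ J, tractorMetric G (x t) (tractorU' G x t) (tractorU' G x t) = 0)
    (ht : t ∈ J) (hell : ∑ a, κ (x t) a * ellForm G x t a = 0) :
    HasDerivAt (fun s => (splitting G κ (x s)).eval G (x s) (tractorU G x s) (tractorU' G x s))
      0 t := by
  refine (h.hasDerivAt_eval hn (c.mapsTo ht) (c.differentiableAt c.smooth ht)
    (c.differentiableAt (c.smooth_tractorU h) ht)
    (c.differentiableAt (c.smooth_tractorU' h) ht)).congr_deriv ?_
  rw [c.ddtTractor_tractorU' h hcircle hproj ht, ← evalBilin_apply, ← evalBilin_apply, map_zero,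
    add_zero, evalBilin_apply]
  -- Skewness of `K`: the sum over `m_{ab}` changes sign when its indices are exchanged, and the
  -- remaining terms cancel in pairs.
  have h1 : (splitting G κ (x t)).eval G (x t) (tractorU' G x t) (tractorU' G x t) = 0 := by
    have h2 : ∑ a, ∑ b, splitSkew G κ a b (x t) * (tractorU' G x t).2.1 a
        * (tractorU' G x t).2.1 b = 0 := by
      have h3 : ∑ a, ∑ b, splitSkew G κ a b (x t) * (tractorU' G x t).2.1 a
          * (tractorU' G x t).2.1 b = -∑ a, ∑ b, splitSkew G κ a b (x t)
          * (tractorU' G x t).2.1 a * (tractorU' G x t).2.1 b := by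
        conv_lhs => rw [Finset.sum_comm]
        simp only [← Finset.sum_neg_distrib]
        exact Finset.sum_congr rfl fun _ _ => Finset.sum_congr rfl fun _ _ => by
          simp only [splitSkew]; ring
      linarith
    simp only [TwoTractor.eval, splitting, h2]
    ring
  rw [show ddtTractor G x (tractorU G x) t = tractorU' G x t from rfl, h1, zero_add]
  exact hell

end LocalCurve

end Curve

/-! ### From the manifold to coordinate charts. -/

section Charts

variable {n : ℕ} {M : Type*} [TopologicalSpace M] [ChartedSpace (Coord n) M]
  [IsManifold (𝓡 n) ∞ M] {e : OpenPartialHomeomorph M (Coord n)}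

/-- The tangent map of a smooth map on an open set, applied to a smooth vector field along a map,
is smooth. -/
theorem contMDiffOn_mfderiv_section {E H E' H' E₀ H₀ : Type*} [NormedAddCommGroup E]
    [NormedSpace ℝ E] [TopologicalSpace H] {I : ModelWithCorners ℝ E H} [NormedAddCommGroup E']
    [NormedSpace ℝ E'] [TopologicalSpace H'] {I' : ModelWithCorners ℝ E' H'}
    [NormedAddCommGroup E₀] [NormedSpace ℝ E₀] [TopologicalSpace H₀]
    {I₀ : ModelWithCorners ℝ E₀ H₀} {N N' N₀ : Type*} [TopologicalSpace N] [ChartedSpace H N]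
    [IsManifold I 1 N] [TopologicalSpace N'] [ChartedSpace H' N'] [IsManifold I' 1 N']
    [TopologicalSpace N₀] [ChartedSpace H₀ N₀] {f : N → N'} {s : Set N} (hs : IsOpen s)
    (hf : ContMDiffOn I I' ∞ f s) {b : N₀ → N} {u : Set N₀} (v : ∀ y, TangentSpace I (b y))
    (hv : ContMDiffOn I₀ I.tangent ∞ (fun y => (⟨b y, v y⟩ : TangentBundle I N)) u)
    (hb : Set.MapsTo b u s) :
    ContMDiffOn I₀ I'.tangent ∞
      (fun y => (⟨f (b y), mfderiv I I' f (b y) (v y)⟩ : TangentBundle I' N')) u := by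
  have h1 := (hf.contMDiffOn_tangentMapWithin (m := ∞) (by simp) hs.uniqueMDiffOn).comp hv
    (fun y hy => hb hy)
  refine h1.congr fun y hy => ?_
  simp only [Function.comp, tangentMapWithin, mfderivWithin_of_isOpen hs (hb hy)]

/-- The coordinate vector fields are smooth. -/
theorem contMDiffOn_coordField (he : e ∈ charts n M) (v : Coord n) :
    ContMDiffOn (𝓡 n) (𝓡 n).tangent ∞ (fun y => (⟨e.symm y,
      mfderiv (𝓡 n) (𝓡 n) e.symm y v⟩ : TangentBundle (𝓡 n) M)) e.target := by
  have : IsManifold (𝓡 n) 1 M := IsManifold.of_le (n := ∞) (by simp)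
  refine contMDiffOn_mfderiv_section e.open_target (contMDiffOn_symm_of_mem_maximalAtlas he)
    (b := fun y => y) (fun _ => v) (fun y _ => ?_) (Set.mapsTo_id _)
  exact contMDiffWithinAt_vectorSpace_iff_contDiffWithinAt.2 contDiffWithinAt_const

/-- The components are the smooth metric section applied to two smooth coordinate vector fields. -/
theorem PseudoMetric.contDiffOn_comp (g : PseudoMetric n M) (he : e ∈ charts n M) (i j : Fin n) :
    ContDiffOn ℝ ∞ (fun y => g.comp e y i j) e.target := by
  have : IsManifold (𝓡 n) 1 M := IsManifold.of_le (n := ∞) (by simp)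
  have h1 : ContMDiffOn (𝓡 n) ((𝓡 n).prod 𝓘(ℝ)) ∞ (fun y => Bundle.TotalSpace.mk' ℝ
      (E := Bundle.Trivial M ℝ) (e.symm y) (g.comp e y i j)) e.target := by
    apply ContMDiffOn.clm_bundle_apply₂ (F₁ := Coord n) (F₂ := Coord n)
    · exact g.contMDiff.comp_contMDiffOn (contMDiffOn_symm_of_mem_maximalAtlas he)
    · exact contMDiffOn_coordField he _
    · exact contMDiffOn_coordField he _
  intro y hy
  have h2 := h1 y hy
  simp only [Bundle.contMDiffWithinAt_totalSpace] at h2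
  exact h2.2.contDiffWithinAt

theorem contDiffOn_vecComp (he : e ∈ charts n M) {k : ∀ x : M, TangentSpace (𝓡 n) x}
    (hk : ContMDiff (𝓡 n) (𝓡 n).tangent ∞ (fun x => (⟨x, k x⟩ : TangentBundle (𝓡 n) M)))
    (i : Fin n) : ContDiffOn ℝ ∞ (fun y => vecComp k e y i) e.target := by
  have : IsManifold (𝓡 n) 1 M := IsManifold.of_le (n := ∞) (by simp)
  have h1 := contMDiffOn_mfderiv_section e.open_source (contMDiffOn_of_mem_maximalAtlas he)
    (b := e.symm) (fun y => k (e.symm y))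
    (hk.comp_contMDiffOn (contMDiffOn_symm_of_mem_maximalAtlas he)) e.symm.mapsTo
  have h2 : ContDiffOn ℝ ∞ (fun y => (mfderiv (𝓡 n) (𝓡 n) e (e.symm y) (k (e.symm y)) : Coord n))
      e.target := fun y hy => ContMDiffWithinAt.contDiffWithinAt <|
    (contMDiff_snd_tangentBundle_modelSpace (Coord n) (𝓡 n)).contMDiffAt.comp_contMDiffWithinAt _
      (h1 y hy)
  exact (EuclideanSpace.proj i : Coord n →L[ℝ] ℝ).contDiff.comp_contDiffOn h2

theorem PseudoMetric.dot_comp (g : PseudoMetric n M) (e : OpenPartialHomeomorph M (Coord n))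
    (y : Coord n) (v w : Coord n) : dot (g.comp e) y v w
      = g.inner (e.symm y) (mfderiv (𝓡 n) (𝓡 n) e.symm y v)
        (mfderiv (𝓡 n) (𝓡 n) e.symm y w) := by
  let D : Coord n →L[ℝ] Coord n := mfderiv (𝓡 n) (𝓡 n) e.symm y
  let B : Coord n →L[ℝ] Coord n →L[ℝ] ℝ := g.inner (e.symm y)
  change _ = B (D v) (D w)
  have hv (v : Coord n) : v = ∑ i, v i • EuclideanSpace.single i (1 : ℝ) := by
    ext b; simp [Finset.sum_apply, Pi.single_apply]
  conv_rhs => rw [hv v, hv w]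
  simp only [map_sum, map_smul, _root_.sum_apply, _root_.smul_apply,
    smul_eq_mul, Finset.mul_sum]
  rw [dot, Finset.sum_comm]
  refine Finset.sum_congr rfl fun i _ => Finset.sum_congr rfl fun j _ => ?_
  change B (D _) (D _) * _ * _ = _
  ring

theorem PseudoMetric.comp_symm (g : PseudoMetric n M) (e : OpenPartialHomeomorph M (Coord n))
    (y : Coord n) : (g.comp e y).transpose = g.comp e y := by
  ext i j; exact g.symm _ _ _

/-- A kernel vector of the matrix would give a tangent vector orthogonal to everything, because the
chart derivative is invertible. Nondegeneracy then forces it to be zero. -/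
theorem PseudoMetric.det_comp_ne_zero (g : PseudoMetric n M) (he : e ∈ charts n M) {y : Coord n}
    (hy : y ∈ e.target) : (g.comp e y).det ≠ 0 := by
  intro h0
  obtain ⟨v, hv0, hv⟩ := Matrix.exists_mulVec_eq_zero_iff.2 h0
  have hd : e.MDifferentiable (𝓡 n) (𝓡 n) :=
    ⟨(contMDiffOn_of_mem_maximalAtlas he).mdifferentiableOn (by simp),
      (contMDiffOn_symm_of_mem_maximalAtlas he).mdifferentiableOn (by simp)⟩
  have hsource : e.symm y ∈ e.source := e.map_target hy
  have h1 := hd.symm_comp_deriv hsource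
  have h2 := hd.comp_symm_deriv hy
  rw [e.right_inv hy] at h1
  have h3 : mfderiv (𝓡 n) (𝓡 n) e.symm y (WithLp.toLp 2 v : Coord n) = 0 := by
    refine g.nondeg _ _ fun w => ?_
    have hw : mfderiv (𝓡 n) (𝓡 n) e.symm y (mfderiv (𝓡 n) (𝓡 n) e (e.symm y) w) = w :=
      congrArg (fun L => L w) h1
    rw [g.symm, ← hw]
    refine (g.dot_comp e y (mfderiv (𝓡 n) (𝓡 n) e (e.symm y) w) (WithLp.toLp 2 v)).symm.trans ?_
    rw [← dotProduct_mulVec_eq_dot]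
    change _ ⬝ᵥ (g.comp e y).mulVec v = 0
    rw [hv, dotProduct_zero]
  have h4 : (WithLp.toLp 2 v : Coord n) = 0 := by
    have : mfderiv (𝓡 n) (𝓡 n) e (e.symm y)
        (mfderiv (𝓡 n) (𝓡 n) e.symm y (WithLp.toLp 2 v : Coord n)) = (WithLp.toLp 2 v : Coord n) :=
      congrArg (fun L => L (WithLp.toLp 2 v : Coord n)) h2
    exact this.symm.trans ((congrArg _ h3).trans (ContinuousLinearMap.map_zero _))
  exact hv0 (congrArg WithLp.ofLp h4)

theorem localKilling_chart (g : PseudoMetric n M) {k : ∀ x : M, TangentSpace (𝓡 n) x}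
    (hk : ContMDiff (𝓡 n) (𝓡 n).tangent ∞ (fun x => (⟨x, k x⟩ : TangentBundle (𝓡 n) M)))
    (hkilling : IsConformalKilling g k) (he : e ∈ charts n M) :
    LocalKilling (g.comp e) (vecComp k e) ⟨e.target, e.open_target⟩ where
  smooth_metric := g.contDiffOn_comp he
  symm y _ := g.comp_symm e y
  det_ne_zero _ hy := g.det_comp_ne_zero he hy
  smooth_field := contDiffOn_vecComp he hk
  killing := hkilling e he

/-- Differentiation is local, so it is enough to work on the open set of times at which the curve
lies in the chart domain. -/
theorem localCurve_chart (g : PseudoMetric n M) {γ : ℝ → M} {J : Set ℝ} (hJ : IsOpen J)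
    (hγ : ContMDiffOn 𝓘(ℝ, ℝ) (𝓡 n) ∞ γ J) (hnull : IsNowhereNull g γ J) (he : e ∈ charts n M) :
    LocalCurve (g.comp e) ⟨e.target, e.open_target⟩ (curveComp γ e) (J ∩ γ ⁻¹' e.source) where
  isOpen := hγ.continuousOn.isOpen_inter_preimage hJ e.open_source
  smooth := ((contMDiffOn_of_mem_maximalAtlas he).comp (hγ.mono Set.inter_subset_left)
    Set.inter_subset_right).contDiffOn
  mapsTo _ ht := e.map_source ht.2
  nonnull t ht := hnull e he t ht.1 ht.2

end Charts

end ConformalTractor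

end

theorem mainTheorem11 {n : ℕ} (hn : 3 ≤ n) {M : Type*} [TopologicalSpace M]
    [ChartedSpace (ConformalTractor.Coord n) M] [IsManifold (𝓡 n) ∞ M]
    (c : ConformalTractor.ConformalStructure n M)
    (J : Set ℝ) (hJ : IsOpen J) (γ : ℝ → M) (hγ : ContMDiffOn 𝓘(ℝ, ℝ) (𝓡 n) ∞ γ J)
    (k : ∀ x : M, TangentSpace (𝓡 n) x)
    (hk : ContMDiff (𝓡 n) (𝓡 n).tangent ∞ (fun x => (⟨x, k x⟩ : TangentBundle (𝓡 n) M)))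
    (g : ConformalTractor.PseudoMetric n M) (hg : g ∈ c.scales)
    (hnull : ConformalTractor.IsNowhereNull g γ J)
    (hcircle : ConformalTractor.IsConformalCircle g γ J)
    (hproj : ConformalTractor.IsProjectiveParameter g γ J)
    (hkilling : ConformalTractor.IsConformalKilling g k)
    (hell : ConformalTractor.AnnihilatesEll g γ J k) :
    ∀ e ∈ ConformalTractor.charts n M, ∀ t ∈ J, γ t ∈ e.source →
      HasDerivAt (ConformalTractor.conserved g γ k e) 0 t := by
  intro e he t ht hte
  exact (ConformalTractor.localCurve_chart g hJ hγ hnull he).hasDerivAt_eval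
    (ConformalTractor.localKilling_chart g hk hkilling he) hn
    (fun s hs => hcircle e he s hs.1 hs.2) (fun s hs => hproj e he s hs.1 hs.2) ⟨ht, hte⟩
    (hell e he t ht hte)
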